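/- **Theorem.** Let $\mathcal A$ be an idempotent-complete additive category such that, for every object $A\in\mathcal A$, the endomorphism ring $\mathrm{Hom}(A,A)$ is artinian (on at least one side: for each $A$ it is left artinian or right artinian). Let $\mathcal A^{\oplus}$ denote $\mathcal A$ with the split exact structure, whose admissible exact sequences are those isomorphic to $A\to A\oplus C\to C$. Then $$K_n(\mathcal A^{\oplus})=0\qquad\text{for all } n<0 .$$ Here the negative $K$-groups of an additive category with its split exact structure are Bass' negative $K$-groups, defined as follows. For an additive category $\mathcal C$, let $K_0(\mathcal C)$ be the Grothendieck group of the idempotent completion of $\mathcal C$: the free abelian group on isomorphism classes of objects modulo the relations $[X]-[Y]+[Z]=0$ for every split exact sequence $X\to Y\to Z$. Let $\mathcal C[t]$, $\mathcal C[t^{-1}]$ and $\mathcal C[t,t^{-1}]$ be the additive categories with the same objects as $\mathcal C$ and with morphism groups $\mathrm{Hom}_{\mathcal C}(X,Y)\otimes\mathbb Z[t]$, $\mathrm{Hom}_{\mathcal C}(X,Y)\otimes\mathbb Z[t^{-1}]$ and $\mathrm{Hom}_{\mathcal C}(X,Y)\otimes\mathbb Z[t,t^{-1}]$ respectively. For $m\ge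 1$, $$K_{-m}(\mathcal C)=\operatorname{coker}\Big(K_{1-m}(\mathcal C[t])\oplus K_{1-m}(\mathcal C[t^{-1}])\longrightarrow K_{1-m}(\mathcal C[t,t^{-1}])\Big).$$ -/

import Mathlib

open CategoryTheory CategoryTheory.Limits CategoryTheory.Idempotents

universe v u

noncomputable section

namespace NegativeK

/-! ### The category of additive categories -/

set_option linter.checkUnivs false in
/-- An additive category: a preadditive category with finite biproducts (in particular with a
zero object). -/
structure AdditiveCat : Type (max (u + 1) (v + 1)) where
  of ::
  /-- the underlying type of objects -/
  carrier : Type u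
  [category : Category.{v} carrier]
  [preadditive : Preadditive carrier]
  [hasFiniteBiproducts : HasFiniteBiproducts carrier]

attribute [instance] AdditiveCat.category AdditiveCat.preadditive AdditiveCat.hasFiniteBiproducts

namespace AdditiveCat

/-- Morphisms of additive categories are additive functors. -/
structure Hom (C D : AdditiveCat.{v, u}) where
  /-- the underlying functor -/
  functor : C.carrier ⥤ D.carrier
  [additive : functor.Additive]

attribute [instance] Hom.additive

theorem Hom.ext_functor {C D : AdditiveCat.{v, u}} {F G : Hom C D}
    (h : F.functor = G.functor) : F = G := by
  cases F; cases G; cases h; rfl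

instance : Category AdditiveCat.{v, u} where
  Hom C D := Hom C D
  id C := { functor := 𝟭 C.carrier }
  comp F G := { functor := F.functor ⋙ G.functor }

theorem hom_ext {C D : AdditiveCat.{v, u}} {F G : C ⟶ D}
    (h : Hom.functor F = Hom.functor G) : F = G :=
  Hom.ext_functor h

end AdditiveCat

/-! ### The Grothendieck group for the split exact structure -/

section GrothendieckGroup

/-- The free abelian group on the isomorphism classes of objects. -/
abbrev FreeOnIsoClasses (C : Type u) [Category.{v} C] : Type u :=
  FreeAbelianGroup (Quotient (isIsomorphicSetoid C))

/-- The generator given by the isomorphism class of an object. -/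
def isoClass {C : Type u} [Category.{v} C] (X : C) : FreeOnIsoClasses C :=
  FreeAbelianGroup.of (Quotient.mk (isIsomorphicSetoid C) X)

/-- The homomorphism `[X] ↦ [F X]` on free abelian groups. -/
def freeMap {C D : Type u} [Category.{v} C] [Category.{v} D] (F : C ⥤ D) :
    FreeOnIsoClasses C →+ FreeOnIsoClasses D :=
  FreeAbelianGroup.lift (Quotient.lift (fun X => isoClass (F.obj X)) (by
    rintro X Y ⟨e⟩
    exact congrArg FreeAbelianGroup.of (Quotient.sound ⟨F.mapIso e⟩)))

theorem freeMap_isoClass {C D : Type u} [Category.{v} C] [Category.{v} D] (F : C ⥤ D) (X : C) :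
    freeMap F (isoClass X) = isoClass (F.obj X) :=
  FreeAbelianGroup.lift_apply_of _ _

variable (C : Type u) [Category.{v} C] [Preadditive C]

/-- The subgroup generated by the expressions `[X₁] - [X₂] + [X₃]`, one for each split exact
sequence `X₁ ⟶ X₂ ⟶ X₃`. -/
def splitRelations : AddSubgroup (FreeOnIsoClasses C) :=
  AddSubgroup.closure {x | ∃ S : ShortComplex C, Nonempty S.Splitting ∧
    x = isoClass S.X₁ - isoClass S.X₂ + isoClass S.X₃}

/-- The Grothendieck group of an additive category with its split exact structure. -/
def SplitK₀ : Type u := FreeOnIsoClasses C ⧸ splitRelations C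

instance : AddCommGroup (SplitK₀ C) :=
  inferInstanceAs (AddCommGroup (FreeOnIsoClasses C ⧸ splitRelations C))

variable {C} {D : Type u} [Category.{v} D] [Preadditive D]

/-- The class of an object in the Grothendieck group. -/
def SplitK₀.mk (X : C) : SplitK₀ C := QuotientAddGroup.mk (isoClass X)

theorem SplitK₀.hom_ext {A : Type*} [AddCommGroup A] {f g : SplitK₀ C →+ A}
    (h : ∀ X, f (SplitK₀.mk X) = g (SplitK₀.mk X)) : f = g := by
  refine QuotientAddGroup.addMonoidHom_ext _ (FreeAbelianGroup.lift_ext _ _ ?_)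
  rintro ⟨X⟩
  exact h X

/-- The homomorphism `[X] ↦ [F X]` on Grothendieck groups induced by an additive functor. -/
def SplitK₀.map (F : C ⥤ D) [F.Additive] : SplitK₀ C →+ SplitK₀ D :=
  QuotientAddGroup.map _ _ (freeMap F) (by
    rw [splitRelations, AddSubgroup.closure_le]
    rintro _ ⟨S, ⟨s⟩, rfl⟩
    refine AddSubgroup.subset_closure ⟨S.map F, ⟨s.map F⟩, ?_⟩
    rw [map_add, map_sub, freeMap_isoClass, freeMap_isoClass, freeMap_isoClass]
    rfl)

theorem SplitK₀.map_mk (F : C ⥤ D) [F.Additive] (X : C) :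
    SplitK₀.map F (SplitK₀.mk X) = SplitK₀.mk (F.obj X) :=
  congrArg QuotientAddGroup.mk (freeMap_isoClass F X)

end GrothendieckGroup

/-- The Grothendieck group of the split exact structure, as a functor. -/
def splitK₀ : AdditiveCat.{v, u} ⥤ AddCommGrpCat.{u} where
  obj C := AddCommGrpCat.of (SplitK₀ C.carrier)
  map F := AddCommGrpCat.ofHom (SplitK₀.map F.functor)
  map_id C := by
    ext1
    refine SplitK₀.hom_ext fun X => ?_
    exact SplitK₀.map_mk _ X
  map_comp F G := by
    ext1
    refine SplitK₀.hom_ext fun X => ?_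
    change SplitK₀.map (F.functor ⋙ G.functor) (SplitK₀.mk X) =
      SplitK₀.map G.functor (SplitK₀.map F.functor (SplitK₀.mk X))
    rw [SplitK₀.map_mk, SplitK₀.map_mk, SplitK₀.map_mk]
    rfl

/-! ### Idempotent completion -/

/-- The extension of a functor to idempotent completions, `(X, p) ↦ (F X, F p)`. -/
def karoubiMap {C D : Type u} [Category.{v} C] [Category.{v} D] (F : C ⥤ D) :
    Karoubi C ⥤ Karoubi D where
  obj P := ⟨F.obj P.X, F.map P.p, by rw [← F.map_comp, P.idem]⟩
  map f := ⟨F.map f.f, by simp only [← F.map_comp, f.comm]⟩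
  map_id _ := rfl
  map_comp f g := Karoubi.hom_ext _ _ (F.map_comp f.f g.f)

instance {C D : Type u} [Category.{v} C] [Category.{v} D] [Preadditive C] [Preadditive D]
    (F : C ⥤ D) [F.Additive] : (karoubiMap F).Additive where
  map_add {_ _ f g} := Karoubi.hom_ext _ _ (F.map_add (f := f.f) (g := g.f))

/-- Idempotent completion, as a functor. -/
def idempotentCompletion : AdditiveCat.{v, u} ⥤ AdditiveCat.{v, max u v} where
  obj C := AdditiveCat.of (Karoubi C.carrier)
  map F := { functor := karoubiMap F.functor }
  map_id _ := rfl
  map_comp _ _ := rfl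

/-- `K₀` of the idempotent completion. On an idempotent-complete additive category this is the
Grothendieck group; on any additive category it is the zeroth group of nonconnective
`K`-theory. For instance, on the category of finitely generated free modules over a ring it is
`K₀` of the ring. -/
def K₀ : AdditiveCat.{v, u} ⥤ AddCommGrpCat.{max u v} := idempotentCompletion ⋙ splitK₀

/-! ### Polynomial and Laurent polynomial extensions of an additive category -/

/-- The extension `C[M]` of an additive category `C` by a commutative monoid `M`, written
additively. Its objects are those of `C` and its morphisms `X ⟶ Y` are the formal sums
`∑ m, φ m t ^ m` with coefficients `φ m : X ⟶ Y` in `C`. For `M = ℕ` it is the polynomial category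
`C[t]`, for `M = ℤ` the Laurent polynomial category `C[t, t⁻¹]`. -/
structure Extension (M : Type) (C : Type u) where
  of ::
  /-- the underlying object -/
  as : C

namespace Extension

variable {M N P : Type} [AddCommMonoid M] [AddCommMonoid N] [AddCommMonoid P]
variable {C : Type u} [Category.{v} C] [Preadditive C]
variable {D : Type u} [Category.{v} D] [Preadditive D]

/-- Convolution of formal sums: `(f t ^ a) ≫ (g t ^ b) = (f ≫ g) t ^ (a + b)`, extended
biadditively. -/
def conv {X Y Z : C} : (M →₀ (X ⟶ Y)) →+ (M →₀ (Y ⟶ Z)) →+ (M →₀ (X ⟶ Z)) :=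
  Finsupp.liftAddHom fun a => AddMonoidHom.flip (Finsupp.liftAddHom fun b =>
    AddMonoidHom.flip (AddMonoidHom.compr₂ (Preadditive.compHom (P := X) (Q := Y) (R := Z))
      (Finsupp.singleAddHom (a + b))))

theorem conv_single {X Y Z : C} (a b : M) (f : X ⟶ Y) (g : Y ⟶ Z) :
    conv (Finsupp.single a f) (Finsupp.single b g) = Finsupp.single (a + b) (f ≫ g) := by
  simp [conv]
  rfl

theorem single_zero_conv {X Y : C} (f : M →₀ (X ⟶ Y)) :
    conv (Finsupp.single 0 (𝟙 X)) f = f := by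
  induction f using Finsupp.induction_linear with
  | zero => exact map_zero _
  | add f g hf hg => rw [map_add, hf, hg]
  | single a f => rw [conv_single, zero_add, Category.id_comp]

theorem conv_single_zero {X Y : C} (f : M →₀ (X ⟶ Y)) :
    conv f (Finsupp.single 0 (𝟙 Y)) = f := by
  induction f using Finsupp.induction_linear with
  | zero => rw [map_zero, AddMonoidHom.zero_apply]
  | add f g hf hg => rw [map_add, AddMonoidHom.add_apply, hf, hg]
  | single a f => rw [conv_single, add_zero, Category.comp_id]

theorem conv_assoc {W X Y Z : C} (f : M →₀ (W ⟶ X)) (g : M →₀ (X ⟶ Y)) (h : M →₀ (Y ⟶ Z)) :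
    conv (conv f g) h = conv f (conv g h) := by
  induction f using Finsupp.induction_linear with
  | zero => simp only [map_zero, AddMonoidHom.zero_apply]
  | add f f' hf hf' => simp only [map_add, AddMonoidHom.add_apply, hf, hf']
  | single a f =>
    induction g using Finsupp.induction_linear with
    | zero => simp only [map_zero, AddMonoidHom.zero_apply]
    | add g g' hg hg' => simp only [map_add, AddMonoidHom.add_apply, hg, hg']
    | single b g =>
      induction h using Finsupp.induction_linear with
      | zero => simp only [map_zero]
      | add h h' hh hh' => simp only [map_add, hh, hh']
      | single c h => simp only [conv_single, add_assoc, Category.assoc]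

theorem add_conv {X Y Z : C} (f f' : M →₀ (X ⟶ Y)) (g : M →₀ (Y ⟶ Z)) :
    conv (f + f') g = conv f g + conv f' g := by
  rw [map_add, AddMonoidHom.add_apply]

theorem conv_add {X Y Z : C} (f : M →₀ (X ⟶ Y)) (g g' : M →₀ (Y ⟶ Z)) :
    conv f (g + g') = conv f g + conv f g' :=
  map_add _ g g'

instance : Category.{v} (Extension M C) where
  Hom X Y := M →₀ (X.as ⟶ Y.as)
  id X := Finsupp.single 0 (𝟙 X.as)
  comp f g := conv f g
  id_comp := single_zero_conv
  comp_id := conv_single_zero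
  assoc := conv_assoc

instance : Preadditive (Extension M C) where
  homGroup X Y := inferInstanceAs (AddCommGroup (M →₀ (X.as ⟶ Y.as)))
  add_comp _ _ _ f f' g := add_conv f f' g
  comp_add _ _ _ f g g' := conv_add f g g'

/-- The functor `C ⥤ C[M]` sending a morphism `f` to `f t ^ 0`. -/
def constants (M : Type) [AddCommMonoid M] (C : Type u) [Category.{v} C] [Preadditive C] :
    C ⥤ Extension M C where
  obj X := ⟨X⟩
  map f := Finsupp.single 0 f
  map_id _ := rfl
  map_comp f g := by
    refine Eq.trans ?_ (conv_single 0 0 f g).symm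
    rw [add_zero]

instance : (constants M C).Additive where
  map_add {_ _ f g} := Finsupp.single_add 0 f g

instance [HasFiniteBiproducts C] : HasFiniteBiproducts (Extension M C) where
  out _ := ⟨fun f =>
    (constants M C).hasBiproduct_of_preserves' (fun j => (f j).as)⟩

/-- The functor `C[M] ⥤ D[N]` induced by an additive functor `F : C ⥤ D` and a homomorphism
`φ : M →+ N`, sending `f t ^ m` to `(F f) t ^ (φ m)`. -/
def mapHom (F : C ⥤ D) [F.Additive] (φ : M →+ N) (X Y : C) :
    (M →₀ (X ⟶ Y)) →+ (N →₀ (F.obj X ⟶ F.obj Y)) :=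
  Finsupp.liftAddHom fun m => (Finsupp.singleAddHom (φ m)).comp F.mapAddHom

theorem mapHom_single (F : C ⥤ D) [F.Additive] (φ : M →+ N) {X Y : C} (m : M) (f : X ⟶ Y) :
    mapHom F φ X Y (Finsupp.single m f) = Finsupp.single (φ m) (F.map f) := by
  simp [mapHom]

theorem mapHom_conv (F : C ⥤ D) [F.Additive] (φ : M →+ N) {X Y Z : C}
    (f : M →₀ (X ⟶ Y)) (g : M →₀ (Y ⟶ Z)) :
    mapHom F φ X Z (conv f g) = conv (mapHom F φ X Y f) (mapHom F φ Y Z g) := by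
  induction f using Finsupp.induction_linear with
  | zero => simp only [map_zero, AddMonoidHom.zero_apply]
  | add f f' hf hf' => simp only [map_add, AddMonoidHom.add_apply, hf, hf']
  | single a f =>
    induction g using Finsupp.induction_linear with
    | zero => simp only [map_zero]
    | add g g' hg hg' => simp only [map_add, hg, hg']
    | single b g => simp only [conv_single, mapHom_single, map_add, F.map_comp]

/-- The functor `C[M] ⥤ D[N]` induced by an additive functor `F : C ⥤ D` and a homomorphism
`φ : M →+ N`: it is `F` on objects and sends `f t ^ m` to `(F f) t ^ (φ m)`. -/
def map (F : C ⥤ D) [F.Additive] (φ : M →+ N) : Extension M C ⥤ Extension N D where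
  obj X := ⟨F.obj X.as⟩
  map {X Y} f := mapHom F φ X.as Y.as f
  map_id X := by
    refine (mapHom_single F φ 0 (𝟙 X.as)).trans ?_
    rw [map_zero, F.map_id]
    rfl
  map_comp f g := mapHom_conv F φ f g

instance (F : C ⥤ D) [F.Additive] (φ : M →+ N) : (map F φ).Additive where
  map_add {X Y f g} := map_add (mapHom F φ X.as Y.as) f g

theorem map_id_eq : map (𝟭 C) (AddMonoidHom.id M) = 𝟭 (Extension M C) :=
  CategoryTheory.Functor.hext (fun _ => rfl) fun X Y f => heq_of_eq <| by
    change mapHom (𝟭 C) (AddMonoidHom.id M) X.as Y.as f = f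
    induction f using Finsupp.induction_linear with
    | zero => exact map_zero _
    | add f g hf hg => exact (map_add _ f g).trans (congrArg₂ (· + ·) hf hg)
    | single m f => exact mapHom_single _ _ m f

theorem map_comp_eq {E : Type u} [Category.{v} E] [Preadditive E] (F : C ⥤ D) [F.Additive]
    (G : D ⥤ E) [G.Additive] (φ : M →+ N) (ψ : N →+ P) :
    map (F ⋙ G) (ψ.comp φ) = map F φ ⋙ map G ψ :=
  CategoryTheory.Functor.hext (fun _ => rfl) fun X Y f => heq_of_eq <| by
    change mapHom (F ⋙ G) (ψ.comp φ) X.as Y.as f =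
      mapHom G ψ (F.obj X.as) (F.obj Y.as) (mapHom F φ X.as Y.as f)
    induction f using Finsupp.induction_linear with
    | zero => simp only [map_zero]
    | add f g hf hg => exact (map_add _ f g).trans ((congrArg₂ (· + ·) hf hg).trans (by
        rw [map_add, map_add]))
    | single m f =>
      rw [mapHom_single, mapHom_single, mapHom_single]
      rfl

end Extension

/-- The extension `C ↦ C[M]`, as a functor on additive categories. -/
def extension (M : Type) [AddCommMonoid M] : AdditiveCat.{v, u} ⥤ AdditiveCat.{v, u} where
  obj C := AdditiveCat.of (Extension M C.carrier)
  map F := { functor := Extension.map F.functor (AddMonoidHom.id M) }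
  map_id _ := AdditiveCat.hom_ext Extension.map_id_eq
  map_comp F G := AdditiveCat.hom_ext
    (Extension.map_comp_eq F.functor G.functor (AddMonoidHom.id M) (AddMonoidHom.id M))

/-- The natural functor `C[M] ⥤ C[N]`, `t ^ m ↦ t ^ (φ m)`, for a homomorphism `φ : M →+ N`. -/
def extensionMap {M N : Type} [AddCommMonoid M] [AddCommMonoid N] (φ : M →+ N) :
    extension.{v, u} M ⟶ extension.{v, u} N where
  app C := show AdditiveCat.Hom (AdditiveCat.of (Extension M C.carrier))
      (AdditiveCat.of (Extension N C.carrier)) from { functor := Extension.map (𝟭 C.carrier) φ }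
  naturality C D F := AdditiveCat.hom_ext <|
    (Extension.map_comp_eq F.functor (𝟭 D.carrier) (AddMonoidHom.id M) φ).symm.trans
      (Extension.map_comp_eq (𝟭 C.carrier) F.functor φ (AddMonoidHom.id N))

/-- The inclusion `C[t] ⥤ C[t, t⁻¹]`. -/
def polyInclusion : extension.{v, u} ℕ ⟶ extension.{v, u} ℤ :=
  extensionMap (Nat.castAddMonoidHom ℤ)

/-- The inclusion `C[t⁻¹] ⥤ C[t, t⁻¹]`: the variable of the polynomial category is sent to the
inverse of the variable of the Laurent polynomial category. -/
def polyInvInclusion : extension.{v, u} ℕ ⟶ extension.{v, u} ℤ :=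
  extensionMap (-(Nat.castAddMonoidHom ℤ))

/-! ### Negative `K`-groups -/

universe w

/-- Bass' contraction `LF` of a functor `F` from additive categories to abelian groups:
`LF(C)` is the cokernel of `F(C[t]) ⊕ F(C[t⁻¹]) ⟶ F(C[t, t⁻¹])`. -/
def contraction (F : AdditiveCat.{v, u} ⥤ AddCommGrpCat.{w}) :
    AdditiveCat.{v, u} ⥤ AddCommGrpCat.{w} :=
  cokernel (biprod.desc (Functor.whiskerRight polyInclusion F)
    (Functor.whiskerRight polyInvInclusion F))

/-- The negative `K`-theory functors of additive categories with their split exact structures: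
`negativeK n` is `K₋ₙ`, defined as the `n`-fold contraction of `K₀`. -/
def negativeK (n : ℕ) : AdditiveCat.{v, u} ⥤ AddCommGrpCat.{max u v} :=
  contraction^[n] K₀

end NegativeK

end

/-! Call a ring nil-regular if some quotient by a nilpotent ideal is left noetherian of finite left
global dimension (`NilRegular`). A left or right artinian ring is nil-regular, because its Jacobson
radical is nilpotent with semisimple quotient. By Hilbert's basis and syzygy theorems nil-regularity
passes from `S` to `S[t, t⁻¹]`. Since endomorphism rings in `C[t, t⁻¹]` are Laurent polynomial
rings, the class of additive categories with nil-regular endomorphism rings is closed under `C ↦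
C[t, t⁻¹]`.

On this class `K₀(C[t]) → K₀(C[t, t⁻¹])` is surjective (`epi_map_polyInclusion`), so the first
contraction of `K₀` vanishes. If a functor vanishes on the class, so does its contraction, because
the group whose quotient is taken is already zero. Hence all further contractions vanish.

For the surjectivity, an object of the idempotent completion of `C[t, t⁻¹]` is an idempotent over
`S[t, t⁻¹]` with `S = End X`. Let `S'` be the good quotient of `S`. Over `S'[t, t⁻¹]` the idempotent
gives a projective module `P`. Its integral vectors form a finitely generated `S'[t]`-module of
finite projective dimension. Induction on that dimension writes `[P]` as a difference of classes
extended from `S'[t]` (`stablyExtended_of_isLattice`). Idempotent matrices lift along nilpotent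
kernels, and so do equivalences between them (`MatrixEquivalent.of_map`); this carries the result
back to `S`, and `Realization` turns matrices into objects. -/

noncomputable section

namespace NegativeK

/-! ### Equivalence of idempotent matrices -/

section IdempotentMatrices

variable {R S : Type*} [Ring R] [Ring S] {m n k l : Type*} [Fintype m] [Fintype n]

/-- Murray–von Neumann equivalence of square matrices. -/
def MatrixEquivalent (e : Matrix m m R) (f : Matrix n n R) : Prop :=
  ∃ (u : Matrix m n R) (v : Matrix n m R), u * v = e ∧ v * u = f

theorem MatrixEquivalent.map {e : Matrix m m R} {f : Matrix n n R} (h : MatrixEquivalent e f)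
    (φ : R →+* S) : MatrixEquivalent (e.map φ) (f.map φ) := by
  obtain ⟨u, v, rfl, rfl⟩ := h
  exact ⟨u.map φ, v.map φ, Matrix.map_mul.symm, Matrix.map_mul.symm⟩

theorem isIdempotentElem_map {e : Matrix m m R} (he : IsIdempotentElem e) (φ : R →+* S) :
    IsIdempotentElem (e.map φ) := by
  rw [IsIdempotentElem, ← Matrix.map_mul, he.eq]

theorem isIdempotentElem_fromBlocks {e : Matrix m m R} {f : Matrix n n R}
    (he : IsIdempotentElem e) (hf : IsIdempotentElem f) :
    IsIdempotentElem (Matrix.fromBlocks e 0 0 f) := by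
  simp [IsIdempotentElem, Matrix.fromBlocks_multiply, he.eq, hf.eq]

/-- The entries of `x ^ i` are sums of `i`-fold products of entries of `x`. The induction covers
positive exponents only, hence `N + 1` at the end. -/
theorem isNilpotent_of_mem_ker_mapMatrix [DecidableEq n] (ψ : R →+* S)
    (hψ : IsNilpotent (RingHom.ker ψ)) (x : Matrix n n R)
    (hx : x ∈ RingHom.ker (ψ.mapMatrix : Matrix n n R →+* Matrix n n S)) :
    IsNilpotent x := by
  obtain ⟨N, hN⟩ := hψ
  have hx' : ∀ a b, x a b ∈ RingHom.ker ψ := fun a b =>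
    congrArg (fun M : Matrix n n S => M a b) (RingHom.mem_ker.1 hx)
  have key : ∀ i : ℕ, ∀ a b, (x ^ (i + 1)) a b ∈ RingHom.ker ψ ^ (i + 1) := by
    intro i
    induction i with
    | zero =>
      intro a b
      simpa only [zero_add, pow_one, Submodule.pow_one] using hx' a b
    | succ i ih =>
      intro a b
      rw [pow_succ, Matrix.mul_apply, Submodule.pow_succ]
      refine Ideal.sum_mem _ fun c _ => Ideal.mul_mem_mul (ih a c) (hx' c b)
  refine ⟨N + 1, ?_⟩
  ext a b
  have h : (x ^ (N + 1)) a b ∈ RingHom.ker ψ ^ (N + 1) := key N a b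
  rw [Submodule.pow_succ, hN] at h
  rw [Submodule.zero_eq_bot, Submodule.bot_mul] at h
  exact h

theorem exists_isIdempotentElem_map_eq [DecidableEq n] (ψ : R →+* S)
    (hs : Function.Surjective ψ) (hψ : IsNilpotent (RingHom.ker ψ)) (e : Matrix n n S)
    (he : IsIdempotentElem e) : ∃ f : Matrix n n R, IsIdempotentElem f ∧ f.map ψ = e := by
  have hr : e ∈ (ψ.mapMatrix : Matrix n n R →+* Matrix n n S).range := by
    choose g hg using hs
    refine ⟨e.map g, ?_⟩
    ext a b
    exact hg _
  exact exists_isIdempotentElem_eq_of_ker_isNilpotent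
    (ψ.mapMatrix : Matrix n n R →+* Matrix n n S)
    (fun x hx => isNilpotent_of_mem_ker_mapMatrix ψ hψ x hx) e hr he

/-- Lifts of `u₁` and `v₁`, cut down to the corners of `e` and `f`, are mutually inverse up to a
nilpotent error. A geometric series corrects one composite to `e`. The other is then automatically
`f`, because a nilpotent idempotent is zero. -/
theorem MatrixEquivalent.of_map [DecidableEq m] [DecidableEq n] {e : Matrix m m R}
    {f : Matrix n n R} (he : IsIdempotentElem e) (hf : IsIdempotentElem f) (ψ : R →+* S)
    (hs : Function.Surjective ψ) (hψ : IsNilpotent (RingHom.ker ψ))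
    (h : MatrixEquivalent (e.map ψ) (f.map ψ)) : MatrixEquivalent e f := by
  obtain ⟨u₁, v₁, huv, hvu⟩ := h
  have hes : e.map ψ * e.map ψ = e.map ψ := by rw [← Matrix.map_mul, he.eq]
  have hfs : f.map ψ * f.map ψ = f.map ψ := by rw [← Matrix.map_mul, hf.eq]
  obtain ⟨u₀, hu₀⟩ : ∃ u₀ : Matrix m n R, u₀.map ψ = u₁ := by
    choose g hg using hs
    exact ⟨u₁.map g, by ext; simp [hg]⟩
  obtain ⟨v₀, hv₀⟩ : ∃ v₀ : Matrix n m R, v₀.map ψ = v₁ := by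
    choose g hg using hs
    exact ⟨v₁.map g, by ext; simp [hg]⟩
  obtain ⟨u, hu⟩ : ∃ u, u = e * u₀ * f := ⟨_, rfl⟩
  obtain ⟨v, hv⟩ : ∃ v, v = f * v₀ * e := ⟨_, rfl⟩
  have heu : e * u = u := by rw [hu, ← Matrix.mul_assoc, ← Matrix.mul_assoc, he.eq]
  have huf : u * f = u := by rw [hu, Matrix.mul_assoc, hf.eq]
  have hve : v * e = v := by rw [hv, Matrix.mul_assoc, he.eq]
  have hfv : f * v = v := by rw [hv, ← Matrix.mul_assoc, ← Matrix.mul_assoc, hf.eq]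
  -- The equivalence does not require `u₁ = e u₁ f` over `S`, so the corner of `u₁` is `u₁ v₁ u₁`
  -- and not `u₁` itself.
  have hus : u.map ψ = u₁ * v₁ * u₁ := by
    rw [hu, Matrix.map_mul, Matrix.map_mul, hu₀, ← huv, Matrix.mul_assoc (u₁ * v₁) u₁, ← hvu,
      ← Matrix.mul_assoc u₁, ← Matrix.mul_assoc, huv, hes]
  have hvs : v.map ψ = v₁ * u₁ * v₁ := by
    rw [hv, Matrix.map_mul, Matrix.map_mul, hv₀, ← hvu, Matrix.mul_assoc (v₁ * u₁) v₁, ← huv,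
      ← Matrix.mul_assoc v₁, ← Matrix.mul_assoc, hvu, hfs]
  have huvs : (u * v).map ψ = e.map ψ := by
    rw [Matrix.map_mul, hus, hvs, huv, Matrix.mul_assoc, ← Matrix.mul_assoc u₁,
      ← Matrix.mul_assoc u₁, huv, ← Matrix.mul_assoc, ← Matrix.mul_assoc, hes,
      Matrix.mul_assoc, huv, hes]
  have hvus : v.map ψ * u.map ψ = f.map ψ := by
    rw [hus, hvs, hvu, Matrix.mul_assoc, ← Matrix.mul_assoc v₁,
      ← Matrix.mul_assoc v₁, hvu, ← Matrix.mul_assoc, ← Matrix.mul_assoc, hfs,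
      Matrix.mul_assoc, hvu, hfs]
  obtain ⟨x, hx⟩ : ∃ x, x = e - u * v := ⟨_, rfl⟩
  have hxψ : ψ.mapMatrix x = 0 := by
    rw [hx, map_sub]
    exact sub_eq_zero.2 huvs.symm
  obtain ⟨N, hN⟩ := isNilpotent_of_mem_ker_mapMatrix ψ hψ x hxψ
  obtain ⟨w, hw⟩ : ∃ w, w = ∑ i ∈ Finset.range N, x ^ i := ⟨_, rfl⟩
  have hw1 : (1 - x) * w = 1 := by rw [hw, mul_neg_geom_sum, hN, sub_zero]
  have hws : w.map ψ = 1 := by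
    have := congrArg ψ.mapMatrix hw1
    rwa [map_mul, map_sub, hxψ, map_one, sub_zero, one_mul] at this
  have hex : e * x = x := by rw [hx, mul_sub, he.eq, ← Matrix.mul_assoc, heu]
  have huvw : u * (v * w) = e := by
    have h1 : u * v = e * (1 - x) := by rw [mul_sub, mul_one, hex, hx, sub_sub_cancel]
    rw [← Matrix.mul_assoc, h1, mul_assoc, hw1, mul_one]
  refine ⟨u, v * w, huvw, ?_⟩
  -- `f'` is a subidempotent of `f` congruent to `f` modulo the kernel, so `f - f'` is both
  -- idempotent and nilpotent.
  obtain ⟨f', hf'⟩ : ∃ f', f' = v * w * u := ⟨_, rfl⟩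
  have h1 : f' * f' = f' := by
    rw [hf', Matrix.mul_assoc, ← Matrix.mul_assoc u, huvw, heu]
  have h2 : f' * f = f' := by rw [hf', Matrix.mul_assoc, huf]
  have h3 : f * f' = f' := by rw [hf', ← Matrix.mul_assoc, ← Matrix.mul_assoc, hfv]
  have h4 : (f - f') * (f - f') = f - f' := by
    rw [sub_mul, mul_sub, mul_sub, hf.eq, h1, h2, h3, sub_self, sub_zero]
  obtain ⟨M, hM⟩ := isNilpotent_of_mem_ker_mapMatrix ψ hψ (f - f') (by
    rw [RingHom.mem_ker, map_sub, sub_eq_zero, hf']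
    refine Eq.trans ?_ Matrix.map_mul.symm
    rw [Matrix.map_mul, hws, Matrix.mul_one, hvus]
    rfl)
  rw [← hf']
  refine (sub_eq_zero.1 ?_).symm
  -- Exponent zero means that `1 = 0` in the matrix ring.
  cases M with
  | zero => rw [← mul_one (f - f'), ← pow_zero (f - f'), hM, mul_zero]
  | succ M => rwa [IsIdempotentElem.pow_succ_eq M h4] at hM

end IdempotentMatrices

end NegativeK

end
noncomputable section

namespace NegativeK

/-! ### Noncommutative polynomial and Laurent polynomial rings -/

section NilpotentKernel

variable {R S : Type*} [Ring R] [Ring S]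

/-- Coefficients of a product are sums of products of coefficients, so powers of the kernel have
coefficients in the same powers of `ker ψ`. -/
theorem isNilpotent_ker_mapRingHom (M : Type*) [AddMonoid M] (ψ : R →+* S)
    (hψ : IsNilpotent (RingHom.ker ψ)) :
    IsNilpotent (RingHom.ker (AddMonoidAlgebra.mapRingHom M ψ)) := by
  classical
  obtain ⟨N, hN⟩ := hψ
  have hK : ∀ x ∈ RingHom.ker (AddMonoidAlgebra.mapRingHom M ψ), ∀ m,
      x.coeff m ∈ RingHom.ker ψ := by
    intro x hx m
    rw [RingHom.mem_ker, ← AddMonoidAlgebra.coeff_mapRingHom, RingHom.mem_ker.1 hx]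
    rfl
  have key : ∀ i : ℕ, ∀ x ∈ RingHom.ker (AddMonoidAlgebra.mapRingHom M ψ) ^ (i + 1), ∀ m,
      x.coeff m ∈ RingHom.ker ψ ^ (i + 1) := by
    intro i
    induction i with
    | zero => simpa only [zero_add, Submodule.pow_one] using hK
    | succ i ih =>
      intro x hx
      rw [Submodule.pow_succ] at hx
      induction hx using Submodule.mul_induction_on' with
      | mem_mul_mem a ha b hb =>
        intro m
        rw [AddMonoidAlgebra.coeff_mul, Submodule.pow_succ]
        refine Ideal.sum_mem _ fun c _ => Ideal.sum_mem _ fun d _ => ?_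
        dsimp only
        split_ifs
        · exact Ideal.mul_mem_mul (ih a ha c) (hK b hb d)
        · exact Ideal.zero_mem _
      | add a _ b _ ha hb =>
        intro m
        exact Ideal.add_mem _ (ha m) (hb m)
  refine ⟨N + 1, ?_⟩
  rw [Submodule.zero_eq_bot, eq_bot_iff]
  intro x hx
  have h : ∀ m, x.coeff m ∈ RingHom.ker ψ ^ (N + 1) := key N x hx
  rw [Submodule.pow_succ, hN, Submodule.zero_eq_bot, Submodule.bot_mul] at h
  exact AddMonoidAlgebra.coeff_injective (Finsupp.ext h)

end NilpotentKernel

/-! ### Hilbert's basis theorem through ideals of top coefficients. -/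

section HilbertBasis

open Polynomial

variable {R : Type*} [Ring R]

/-- The left ideal of coefficients in degree `n` of the elements of degree at most `n` of a left
ideal of `R[X]`. -/
def topCoeffIdeal (I : Ideal R[X]) (n : ℕ) : Ideal R where
  carrier := {a | ∃ p ∈ I, p.natDegree ≤ n ∧ p.coeff n = a}
  add_mem' := by
    rintro _ _ ⟨p, hp, hpn, rfl⟩ ⟨q, hq, hqn, rfl⟩
    exact ⟨p + q, I.add_mem hp hq, natDegree_add_le_of_degree_le hpn hqn, coeff_add _ _ _⟩
  zero_mem' := ⟨0, I.zero_mem, by simp, coeff_zero _⟩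
  smul_mem' := by
    rintro r _ ⟨p, hp, hpn, rfl⟩
    exact ⟨C r * p, I.mul_mem_left _ hp, (natDegree_C_mul_le _ _).trans hpn, coeff_C_mul _⟩

/-- Multiplication by `X` moves the coefficient in degree `n` to degree `n + 1`. -/
theorem topCoeffIdeal_mono (I : Ideal R[X]) : Monotone (topCoeffIdeal I) := by
  refine monotone_nat_of_le_succ fun n => ?_
  rintro _ ⟨p, hp, hpn, rfl⟩
  refine ⟨X * p, I.mul_mem_left _ hp, ?_, coeff_X_mul _ _⟩
  exact natDegree_mul_le.trans ((Nat.add_le_add natDegree_X_le hpn).trans (by omega))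

/-- Equality of the ideals of top coefficients for `J ≤ I` forces `I = J`. -/
theorem le_of_topCoeffIdeal_le {I J : Ideal R[X]} (hJI : J ≤ I)
    (h : ∀ n, topCoeffIdeal I n ≤ topCoeffIdeal J n) : I ≤ J := by
  have key : ∀ n : ℕ, ∀ p ∈ I, p.degree < n → p ∈ J := by
    intro n
    induction n with
    | zero =>
      intro p _ hpn
      rw [degree_eq_bot.1 (Nat.WithBot.lt_zero_iff.1 hpn)]
      exact J.zero_mem
    | succ n ih =>
      intro p hp hpn
      have hpn' : p.natDegree ≤ n := natDegree_le_iff_degree_le.2 (Order.lt_succ_iff.1 hpn)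
      -- Subtracting an element of `J` with the same coefficient in degree `n` lowers the degree.
      obtain ⟨q, hq, hqn, hqp⟩ := h n ⟨p, hp, hpn', rfl⟩
      have hlt : (p - q).degree < n := by
        rw [degree_lt_iff_coeff_zero]
        intro m hm
        rcases hm.eq_or_lt with rfl | hm
        · rw [coeff_sub, hqp, sub_self]
        · exact coeff_eq_zero_of_natDegree_lt ((natDegree_sub_le_of_le hpn' hqn).trans_lt
            (by simpa using hm))
      have := J.add_mem (ih (p - q) (I.sub_mem hp (hJI hq)) hlt) hq
      rwa [sub_add_cancel] at this
  intro p hp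
  exact key (p.natDegree + 1) p hp
    (degree_le_natDegree.trans_lt (by exact_mod_cast Nat.lt_succ_self _))

variable (R) in
/-- **Hilbert's basis theorem** for polynomial rings over noncommutative rings. -/
theorem isNoetherianRing_polynomial [IsNoetherianRing R] : IsNoetherianRing R[X] := by
  refine isNoetherianRing_iff.2 ⟨fun I => ?_⟩
  obtain ⟨N, hN⟩ := monotone_stabilizes_iff_noetherian.2 (inferInstanceAs (IsNoetherian R R))
    ⟨topCoeffIdeal I, topCoeffIdeal_mono I⟩
  have hfin : ∀ n, ∃ s : Finset R[X], (s : Set R[X]) ⊆ I ∧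
      topCoeffIdeal I n ≤ topCoeffIdeal (Ideal.span (s : Set R[X])) n := by
    classical
    intro n
    obtain ⟨t, ht⟩ := IsNoetherian.noetherian (topCoeffIdeal I n)
    have hmem : ∀ a : t, ∃ p ∈ I, p.natDegree ≤ n ∧ p.coeff n = a := fun a =>
      (ht ▸ Submodule.subset_span a.2 : (a : R) ∈ topCoeffIdeal I n)
    choose p hpI hpn hpa using hmem
    refine ⟨Finset.univ.image p, ?_, ?_⟩
    · intro x hx
      obtain ⟨a, -, rfl⟩ := Finset.mem_image.1 (Finset.mem_coe.1 hx)
      exact hpI a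
    · rw [← ht, Submodule.span_le]
      intro a ha
      exact ⟨p ⟨a, ha⟩, Ideal.subset_span (by simp), hpn _, hpa _⟩
  choose s hsI hs using hfin
  classical
  -- The chain of top-coefficient ideals is constant from `N` on, so generators for the degrees `0,
  -- …, N` suffice.
  let J : Ideal R[X] := Ideal.span (((Finset.range (N + 1)).biUnion s : Finset R[X]) : Set R[X])
  have hJI : J ≤ I := by
    refine Ideal.span_le.2 fun x hx => ?_
    obtain ⟨n, -, hn⟩ := Finset.mem_biUnion.1 (Finset.mem_coe.1 hx)
    exact hsI n hn
  have hJ : ∀ n ≤ N, topCoeffIdeal I n ≤ topCoeffIdeal J n := by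
    intro n hn a ha
    obtain ⟨p, hp, hpn, rfl⟩ := hs n ha
    refine ⟨p, Ideal.span_mono ?_ hp, hpn, rfl⟩
    exact Finset.coe_subset.2 (Finset.subset_biUnion_of_mem s (Finset.mem_range.2 (by omega)))
  refine ⟨(Finset.range (N + 1)).biUnion s, le_antisymm hJI
    (le_of_topCoeffIdeal_le hJI fun n => ?_)⟩
  rcases le_total n N with hn | hn
  · exact hJ n hn
  · calc topCoeffIdeal I n = topCoeffIdeal I N := (hN n hn).symm
      _ ≤ topCoeffIdeal J N := hJ N le_rfl
      _ ≤ topCoeffIdeal J n := topCoeffIdeal_mono J hn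

instance isNoetherianRing_addMonoidAlgebra_nat [IsNoetherianRing R] :
    IsNoetherianRing (AddMonoidAlgebra R ℕ) :=
  haveI := isNoetherianRing_polynomial R
  isNoetherianRing_of_ringEquiv _ (Polynomial.toFinsuppIso R)

end HilbertBasis

/-! ### Laurent polynomials as a localization of polynomials. -/

section Laurent

variable (R : Type*) [Ring R]

/-- The inclusion `R[t] → R[t, t⁻¹]`. -/
def polyToLaurent : AddMonoidAlgebra R ℕ →+* AddMonoidAlgebra R ℤ :=
  AddMonoidAlgebra.mapDomainRingHom R (Nat.castAddMonoidHom ℤ)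

theorem polyToLaurent_single (n : ℕ) (r : R) :
    polyToLaurent R (AddMonoidAlgebra.single n r) = AddMonoidAlgebra.single (n : ℤ) r :=
  AddMonoidAlgebra.mapDomain_single

theorem polyToLaurent_injective : Function.Injective (polyToLaurent R) :=
  AddMonoidAlgebra.mapDomain_injective Nat.cast_injective

theorem exists_single_mul_mem_range (x : AddMonoidAlgebra R ℤ) :
    ∃ (n : ℕ) (y : AddMonoidAlgebra R ℕ),
      polyToLaurent R y = AddMonoidAlgebra.single (n : ℤ) 1 * x := by
  obtain ⟨n, y, h⟩ := LaurentPolynomial.exists_T_pow x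
  refine ⟨n, Polynomial.toFinsuppIso R y, ?_⟩
  refine Eq.trans ?_ (h.trans ?_)
  · rfl
  · exact (LaurentPolynomial.commute_T n x).symm.eq

/-- Clearing denominators by a unit shows that every left ideal of `L` is generated by the image of
its preimage in `T`, which is finitely generated. -/
theorem isNoetherianRing_of_forall_exists_isUnit_mul {T L : Type*} [Ring T] [Ring L]
    [IsNoetherianRing T] (φ : T →+* L) (h : ∀ x : L, ∃ c : L, IsUnit c ∧ c * x ∈ φ.range) :
    IsNoetherianRing L := by
  classical
  refine isNoetherianRing_iff.2 ⟨fun (I : Ideal L) => ?_⟩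
  obtain ⟨s, hs⟩ := IsNoetherian.noetherian (I.comap φ)
  refine ⟨s.image φ, ?_⟩
  have hmap : Ideal.map φ (Ideal.span (s : Set T)) =
      Ideal.span ((s.image φ : Finset L) : Set L) := by
    rw [Ideal.map_span, Finset.coe_image]
  refine (hmap.symm.trans ?_ : Ideal.span _ = I)
  rw [show Ideal.span (s : Set T) = I.comap φ from hs]
  refine le_antisymm Ideal.map_comap_le fun x hx => ?_
  obtain ⟨c, ⟨c, rfl⟩, y, hy⟩ := h x
  have : φ y ∈ Ideal.map φ (I.comap φ) :=
    Ideal.mem_map_of_mem φ (show φ y ∈ I from hy ▸ I.mul_mem_left _ hx)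
  have h2 := Ideal.mul_mem_left _ (↑c⁻¹ : L) this
  rwa [hy, Units.inv_mul_cancel_left] at h2

theorem isUnit_single (n : ℤ) : IsUnit (AddMonoidAlgebra.single n (1 : R)) := by
  refine ⟨⟨AddMonoidAlgebra.single n 1, AddMonoidAlgebra.single (-n) 1, ?_, ?_⟩, rfl⟩ <;>
  · rw [AddMonoidAlgebra.single_mul_single]
    rw [AddMonoidAlgebra.one_def, one_mul]
    congr 1
    omega

instance isNoetherianRing_addMonoidAlgebra_int [IsNoetherianRing R] :
    IsNoetherianRing (AddMonoidAlgebra R ℤ) :=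
  isNoetherianRing_of_forall_exists_isUnit_mul (polyToLaurent R) fun x =>
    let ⟨n, y, h⟩ := exists_single_mul_mem_range R x
    ⟨_, isUnit_single R n, y, h⟩

end Laurent

end NegativeK

end
noncomputable section

namespace NegativeK

/-! ### Induced modules over monoid rings -/

/-- The module over `S[G]` induced from an `S`-module `N`: formal sums of elements of `N` indexed
by `G`. -/
def InducedModule (G N : Type*) [AddCommGroup N] : Type _ := G →₀ N

namespace InducedModule

variable {G S N Y : Type*} [Ring S] [AddCommGroup N] [AddCommGroup Y]

instance : AddCommGroup (InducedModule G N) := inferInstanceAs (AddCommGroup (G →₀ N))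

/-- The formal sum with a single term. -/
def single (g : G) : N →+ InducedModule G N := Finsupp.singleAddHom g

/-- The coefficients of a formal sum. -/
def coeff (g : G) : InducedModule G N →+ N := Finsupp.applyAddHom g

theorem coeff_single [DecidableEq G] (g h : G) (n : N) :
    coeff h (single g n) = if g = h then n else 0 :=
  Finsupp.single_apply

theorem exists_coeff_ne_zero_forall_gt [LinearOrder G] {x : InducedModule G N} (hx : x ≠ 0) :
    ∃ g, coeff g x ≠ 0 ∧ ∀ h, g < h → coeff h x = 0 := by
  have hs : (show G →₀ N from x).support.Nonempty := Finsupp.support_nonempty_iff.2 hx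
  refine ⟨_, Finsupp.mem_support_iff.1 (Finset.max'_mem _ hs), fun h hh => ?_⟩
  exact Finsupp.notMem_support_iff.1 fun h2 => hh.not_ge (Finset.le_max' _ _ h2)

@[elab_as_elim]
theorem induction_linear {p : InducedModule G N → Prop} (x : InducedModule G N) (zero : p 0)
    (add : ∀ x y, p x → p y → p (x + y)) (single : ∀ g n, p (single g n)) : p x :=
  Finsupp.induction_linear x zero add single

variable [Module S N]

instance : Module S (InducedModule G N) := inferInstanceAs (Module S (G →₀ N))

theorem smul_single (s : S) (g : G) (n : N) : s • single g n = single g (s • n) :=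
  Finsupp.smul_single s g n

variable [AddCommMonoid G]

/-- Translation of formal sums. -/
def translate (G N : Type*) [AddCommMonoid G] [AddCommGroup N] :
    Multiplicative G →* AddMonoid.End (InducedModule G N) where
  toFun a := (Finsupp.mapDomain.addMonoidHom (a.toAdd + ·) : (G →₀ N) →+ (G →₀ N))
  map_one' := by
    ext x : 1
    refine (congrFun (congrArg Finsupp.mapDomain ?_) x).trans Finsupp.mapDomain_id
    funext g
    exact zero_add g
  map_mul' a b := by
    ext x : 1
    refine (congrFun (congrArg Finsupp.mapDomain ?_) x).trans Finsupp.mapDomain_comp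
    funext g
    exact add_assoc _ _ _

theorem translate_single (a : Multiplicative G) (g : G) (n : N) :
    translate G N a (single g n) = single (a.toAdd + g) n :=
  Finsupp.mapDomain_single

variable (G S N) in
/-- The action of `S[G]` on the induced module. -/
def action : AddMonoidAlgebra S G →+* AddMonoid.End (InducedModule G N) :=
  AddMonoidAlgebra.liftNCRingHom (Module.toAddMonoidEnd S (InducedModule G N)) (translate G N)
    fun s a => by
      ext x : 1
      induction x using induction_linear with
      | zero => simp only [map_zero]
      | add x y hx hy => simp only [map_add, hx, hy]
      | single g n =>
        change s • translate G N a (single g n) = translate G N a (s • single g n)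
        rw [translate_single, smul_single, smul_single, translate_single]

instance : Module (AddMonoidAlgebra S G) (InducedModule G N) :=
  Module.compHom _ (action G S N)

theorem single_smul_single (g h : G) (s : S) (n : N) :
    AddMonoidAlgebra.single g s • single h n = single (g + h) (s • n) := by
  have h1 : action G S N (AddMonoidAlgebra.single g s) =
      Module.toAddMonoidEnd S (InducedModule G N) s * translate G N (Multiplicative.ofAdd g) :=
    AddMonoidAlgebra.liftNC_single _ _ _ _
  change action G S N (AddMonoidAlgebra.single g s) (single h n) = _
  rw [h1]
  change s • translate G N (Multiplicative.ofAdd g) (single h n) = _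
  rw [translate_single, smul_single, toAdd_ofAdd]

instance : IsScalarTower S (AddMonoidAlgebra S G) (InducedModule G N) where
  smul_assoc s a x := by
    induction a using AddMonoidAlgebra.induction_linear with
    | zero => simp only [smul_zero, zero_smul]
    | add a b ha hb => simp only [smul_add, add_smul, ha, hb]
    | single g r =>
      induction x using induction_linear with
      | zero => simp only [smul_zero]
      | add x y hx hy => simp only [smul_add, hx, hy]
      | single h n =>
        rw [AddMonoidAlgebra.smul_single, single_smul_single, single_smul_single, smul_single,
          smul_assoc]

variable [Module (AddMonoidAlgebra S G) Y]

/-- The terms of exponent `0` generate the induced module over `S[G]`. -/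
theorem hom_ext {f f' : InducedModule G N →ₗ[AddMonoidAlgebra S G] Y}
    (h : ∀ n, f (single 0 n) = f' (single 0 n)) : f = f' := by
  ext x
  induction x using induction_linear with
  | zero => simp only [map_zero]
  | add x y hx hy => simp only [map_add, hx, hy]
  | single g n =>
    have : single g n = AddMonoidAlgebra.single g (1 : S) • single (0 : G) n := by
      rw [single_smul_single, add_zero, one_smul]
    rw [this, map_smul, map_smul, h]

variable [Module S Y]

/-- The homomorphism from formal sums underlying `lift`. -/
def liftAddHom (f : N →ₗ[S] Y) : InducedModule G N →+ Y :=
  Finsupp.liftAddHom fun g =>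
    (DistribSMul.toAddMonoidHom Y (AddMonoidAlgebra.single g (1 : S))).comp f.toAddMonoidHom

theorem liftAddHom_single (f : N →ₗ[S] Y) (g : G) (n : N) :
    liftAddHom f (single g n) = AddMonoidAlgebra.single g (1 : S) • f n :=
  Finsupp.liftAddHom_apply_single _ _ _

variable [IsScalarTower S (AddMonoidAlgebra S G) Y]

theorem single_smul_eq (g : G) (s : S) (y : Y) :
    AddMonoidAlgebra.single g s • y = AddMonoidAlgebra.single g (1 : S) • s • y := by
  rw [← one_smul (AddMonoidAlgebra S G) y, ← smul_assoc s, ← mul_smul, ← mul_smul,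
    AddMonoidAlgebra.one_def, AddMonoidAlgebra.smul_single, AddMonoidAlgebra.single_mul_single,
    AddMonoidAlgebra.single_mul_single]
  simp

/-- The universal property of the induced module. -/
def lift (f : N →ₗ[S] Y) : InducedModule G N →ₗ[AddMonoidAlgebra S G] Y where
  toFun := liftAddHom f
  map_add' := map_add _
  map_smul' a x := by
    induction a using AddMonoidAlgebra.induction_linear with
    | zero => simp only [zero_smul, map_zero]
    | add a b ha hb => simp only [add_smul, map_add, ha, hb]
    | single g s =>
      induction x using induction_linear with
      | zero => simp only [smul_zero, map_zero]
      | add x y hx hy => simp only [smul_add, map_add, hx, hy]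
      | single h n =>
        rw [single_smul_single, liftAddHom_single, liftAddHom_single, map_smul, ← single_smul_eq,
          RingHom.id_apply, ← mul_smul, AddMonoidAlgebra.single_mul_single, mul_one]

theorem lift_single (f : N →ₗ[S] Y) (g : G) (n : N) :
    lift f (single g n) = AddMonoidAlgebra.single g (1 : S) • f n :=
  liftAddHom_single f g n

variable (S) in
/-- The inclusion of an `S`-module in the module induced from it. -/
def unit : N →ₗ[S] InducedModule G N where
  toFun := single 0
  map_add' := map_add _
  map_smul' s n := (smul_single s 0 n).symm

/-- Induction is left adjoint to restriction of scalars. An `S`-linear lift of `unit` through the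
free cover of the induced module therefore extends to an `S[G]`-linear section of that cover. -/
instance [Module.Projective S N] :
    Module.Projective (AddMonoidAlgebra S G) (InducedModule G N) := by
  have hs : Function.Surjective
      (Finsupp.linearCombination (AddMonoidAlgebra S G) (id : InducedModule G N → _)) :=
    Finsupp.linearCombination_id_surjective _ _
  obtain ⟨s, h⟩ := Module.projective_lifting_property
    ((Finsupp.linearCombination (AddMonoidAlgebra S G)
      (id : InducedModule G N → _)).restrictScalars S) (unit S : N →ₗ[S] InducedModule G N) hs
  refine ⟨⟨lift s, fun x => ?_⟩⟩
  refine LinearMap.congr_fun (f := (Finsupp.linearCombination (AddMonoidAlgebra S G)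
      (id : InducedModule G N → _)).comp (lift s)) (g := LinearMap.id) (hom_ext fun n => ?_) x
  rw [LinearMap.comp_apply, lift_single, ← AddMonoidAlgebra.one_def, one_smul]
  exact LinearMap.congr_fun h n

end InducedModule

end NegativeK

end
noncomputable section

namespace NegativeK

/-! ### The characteristic sequence of a module over a monoid ring -/

namespace InducedModule

variable {G S N : Type*} [Ring S] [AddCommGroup N] [CommSemiring G]
  [Module S N] [Module (AddMonoidAlgebra S G) N] [IsScalarTower S (AddMonoidAlgebra S G) N]

variable (G S N) in
/-- The endomorphism `n t ^ g ↦ n t ^ (g + 1) - (t n) t ^ g`. -/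
def charMap : InducedModule G N →ₗ[AddMonoidAlgebra S G] InducedModule G N :=
  lift (S := S)
    { toFun := fun n => single 1 n - single 0 (AddMonoidAlgebra.single (1 : G) (1 : S) • n)
      map_add' := fun n n' => by
        simp only [smul_add, map_add]
        abel
      map_smul' := fun s n => by
        rw [RingHom.id_apply, smul_sub, smul_single, smul_single, ← single_smul_eq, ← smul_assoc,
          AddMonoidAlgebra.smul_single, smul_eq_mul, mul_one] }

theorem charMap_single (g : G) (n : N) : charMap G S N (single g n) =
    single (g + 1) n - single g (AddMonoidAlgebra.single (1 : G) (1 : S) • n) := by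
  refine (lift_single _ _ _).trans ?_
  change AddMonoidAlgebra.single g (1 : S) •
    ((single 1 n : InducedModule G N) -
      single 0 (AddMonoidAlgebra.single (1 : G) (1 : S) • n)) = _
  rw [smul_sub, single_smul_single, single_smul_single, one_smul, one_smul, add_zero]

theorem coeff_charMap [IsRightCancelAdd G] (x : InducedModule G N) (g : G) :
    coeff (g + 1) (charMap G S N x) =
      coeff g x - AddMonoidAlgebra.single (1 : G) (1 : S) • coeff (g + 1) x := by
  classical
  induction x using induction_linear with
  | zero => simp only [map_zero, smul_zero, sub_zero]
  | add x y hx hy =>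
    simp only [map_add, hx, hy, smul_add]
    abel
  | single h n =>
    rw [charMap_single, map_sub, coeff_single, coeff_single, coeff_single, coeff_single]
    simp only [add_left_inj]
    split_ifs <;> simp

/-- If `g` is the largest exponent of `x`, the image has at `g + 1` the leading coefficient of `x`,
with nothing to cancel it. -/
theorem charMap_injective [LinearOrder G] [IsStrictOrderedRing G] :
    Function.Injective (charMap G S N) := by
  rw [injective_iff_map_eq_zero]
  intro x hx
  by_contra hne
  obtain ⟨g, hg, hlt⟩ := exists_coeff_ne_zero_forall_gt hne
  have := coeff_charMap (S := S) x g
  rw [hx, map_zero, hlt _ (lt_add_one g), smul_zero, sub_zero] at this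
  exact hg this.symm

variable (G S N) in
/-- The action map `n t ^ g ↦ t ^ g n`. -/
def counit : InducedModule G N →ₗ[AddMonoidAlgebra S G] N := lift (LinearMap.id (R := S))

theorem counit_single (g : G) (n : N) :
    counit G S N (single g n) = AddMonoidAlgebra.single g (1 : S) • n :=
  lift_single _ _ _

theorem counit_surjective : Function.Surjective (counit G S N) := fun n =>
  ⟨single 0 n, by rw [counit_single, ← AddMonoidAlgebra.one_def, one_smul]⟩

theorem counit_comp_charMap : (counit G S N).comp (charMap G S N) = 0 := by
  refine hom_ext fun n => ?_
  rw [LinearMap.comp_apply, charMap_single, map_sub, counit_single, counit_single, ← mul_smul,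
    AddMonoidAlgebra.single_mul_single, mul_one, sub_self]
  rfl

/-- Modulo the range of `charMap`, every `y` is congruent to its value under `counit` placed at
exponent `0`. The hypothesis is this congruence for single terms, which needs a separate induction
for each `G`. -/
theorem exact_charMap_counit
    (h : ∀ (g : G) (n : N), single g n - single 0 (AddMonoidAlgebra.single g (1 : S) • n) ∈
      LinearMap.range (charMap G S N)) :
    Function.Exact (charMap G S N) (counit G S N) := by
  refine fun x => ⟨fun hx => ?_, ?_⟩
  · have key : ∀ y : InducedModule G N,
        y - single 0 (counit G S N y) ∈ LinearMap.range (charMap G S N) := by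
      intro y
      induction y using induction_linear with
      | zero => simp only [map_zero, sub_zero, Submodule.zero_mem]
      | add y z hy hz =>
        rw [map_add, map_add, add_sub_add_comm]
        exact Submodule.add_mem _ hy hz
      | single g n =>
        rw [counit_single]
        exact h g n
    have := key x
    rwa [hx, map_zero, sub_zero] at this
  · rintro ⟨y, rfl⟩
    exact LinearMap.congr_fun counit_comp_charMap y

theorem single_sub_mem_range_succ {g : G}
    (h : ∀ n : N, single g n - single 0 (AddMonoidAlgebra.single g (1 : S) • n) ∈
      LinearMap.range (charMap G S N)) (n : N) :
    single (g + 1) n - single 0 (AddMonoidAlgebra.single (g + 1) (1 : S) • n) ∈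
      LinearMap.range (charMap G S N) := by
  have h1 := h (AddMonoidAlgebra.single (1 : G) (1 : S) • n)
  rw [← mul_smul, AddMonoidAlgebra.single_mul_single, mul_one] at h1
  have h2 := Submodule.add_mem _ (LinearMap.mem_range_self (charMap G S N) (single g n)) h1
  rwa [charMap_single, sub_add_sub_cancel] at h2

theorem single_sub_mem_range_zero (n : N) :
    single 0 n - single 0 (AddMonoidAlgebra.single (0 : G) (1 : S) • n) ∈
      LinearMap.range (charMap G S N) := by
  rw [← AddMonoidAlgebra.one_def, one_smul, sub_self]
  exact Submodule.zero_mem _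

end InducedModule

section

variable {S N : Type*} [Ring S] [AddCommGroup N] [Module S N]

open InducedModule

theorem exact_charMap_counit_nat [Module (AddMonoidAlgebra S ℕ) N]
    [IsScalarTower S (AddMonoidAlgebra S ℕ) N] :
    Function.Exact (charMap ℕ S N) (counit ℕ S N) := by
  refine exact_charMap_counit fun g => ?_
  induction g with
  | zero => exact single_sub_mem_range_zero
  | succ g ih => exact single_sub_mem_range_succ ih

theorem exact_charMap_counit_int [Module (AddMonoidAlgebra S ℤ) N]
    [IsScalarTower S (AddMonoidAlgebra S ℤ) N] :
    Function.Exact (charMap ℤ S N) (counit ℤ S N) := by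
  refine exact_charMap_counit fun g => ?_
  induction g with
  | zero => exact single_sub_mem_range_zero
  | succ g ih => exact single_sub_mem_range_succ ih
  | pred g ih =>
    -- Downward step: the induction hypothesis for `t⁻¹ n`, minus the image of `t⁻¹ n` placed at
    -- exponent `-g - 1`.
    intro n
    have h1 := ih (AddMonoidAlgebra.single (-1 : ℤ) (1 : S) • n)
    have h2 := LinearMap.mem_range_self (charMap ℤ S N)
      (single (-(g : ℤ) - 1) (AddMonoidAlgebra.single (-1 : ℤ) (1 : S) • n))
    rw [charMap_single, ← mul_smul, AddMonoidAlgebra.single_mul_single, add_neg_cancel, mul_one,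
      ← AddMonoidAlgebra.one_def, one_smul, sub_add_cancel] at h2
    rw [← mul_smul, AddMonoidAlgebra.single_mul_single, mul_one, ← sub_eq_add_neg] at h1
    have h3 := Submodule.sub_mem _ h1 h2
    rwa [sub_sub_sub_cancel_left] at h3

end

/-! ### Global dimension -/

/-- The left global dimension of `R` is at most `d`. -/
def GlobalDimensionLE (R : Type v) [Ring R] (d : ℕ) : Prop :=
  ∀ M : ModuleCat.{v} R, HasProjectiveDimensionLT M (d + 1)

theorem globalDimensionLE_zero (R : Type v) [Ring R] [IsSemisimpleRing R] :
    GlobalDimensionLE R 0 := fun M => by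
  rw [zero_add, ← projective_iff_hasProjectiveDimensionLT_one]
  exact (IsProjective.iff_projective M).1 (Module.projective_of_isSemisimpleRing R M)

section

variable {S : Type v} {G : Type} [Ring S] [CommSemiring G] [LinearOrder G] [IsStrictOrderedRing G]

/-- Hilbert's syzygy theorem for single modules: the projective dimension over `S[G]` exceeds the
one over `S` by at most one. If `N` is `S`-projective, the characteristic sequence is a projective
resolution of length one. Otherwise one passes to a syzygy over `S[G]`. -/
theorem hasProjectiveDimensionLT_addMonoidAlgebra
    (hG : ∀ (N : Type v) [AddCommGroup N] [Module S N] [Module (AddMonoidAlgebra S G) N]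
      [IsScalarTower S (AddMonoidAlgebra S G) N],
      Function.Exact (InducedModule.charMap G S N) (InducedModule.counit G S N)) (d : ℕ) :
    ∀ (N : Type v) [AddCommGroup N] [Module S N] [Module (AddMonoidAlgebra S G) N]
      [IsScalarTower S (AddMonoidAlgebra S G) N],
      HasProjectiveDimensionLT (ModuleCat.of S N) (d + 1) →
      HasProjectiveDimensionLT (ModuleCat.of (AddMonoidAlgebra S G) N) (d + 2) := by
  induction d with
  | zero =>
    intro N _ _ _ _ h
    rw [zero_add, ← projective_iff_hasProjectiveDimensionLT_one,
      ← IsProjective.iff_projective] at h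
    have hp : Projective (ModuleCat.of (AddMonoidAlgebra S G) (InducedModule G N)) :=
      (IsProjective.iff_projective _).1 inferInstance
    have hS : (ModuleCat.shortComplexOfCompEqZero (InducedModule.charMap G S N)
        (InducedModule.counit G S N) InducedModule.counit_comp_charMap).ShortExact :=
      ModuleCat.shortComplex_shortExact _ (hG N) InducedModule.charMap_injective
        InducedModule.counit_surjective
    refine hS.hasProjectiveDimensionLT_X₃ 1 ?_ ?_
    · exact (projective_iff_hasProjectiveDimensionLT_one (X := ModuleCat.of _ _)).1 hp
    · change HasProjectiveDimensionLT
        (ModuleCat.of (AddMonoidAlgebra S G) (InducedModule G N)) 2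
      infer_instance
  | succ d ih =>
    intro N _ _ _ _ h
    let f := Finsupp.linearCombination (AddMonoidAlgebra S G) (id : N → N)
    have hf : Function.Surjective f := Finsupp.linearCombination_id_surjective _ _
    have hS := LinearMap.shortExact_shortComplexKer hf
    have hp : Projective (ModuleCat.of (AddMonoidAlgebra S G) (N →₀ AddMonoidAlgebra S G)) :=
      (IsProjective.iff_projective _).1 inferInstance
    rw [hS.hasProjectiveDimensionLT_X₃_iff (d + 1) hp]
    refine ih _ ?_
    -- `S[G]` is free over `S`, so the same kernel is also a syzygy of `N` over `S` and the
    -- dimension drops on both sides.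
    have hS' := LinearMap.shortExact_shortComplexKer
      (f := f.restrictScalars S) (by exact hf)
    have hp' : Projective (ModuleCat.of S (N →₀ AddMonoidAlgebra S G)) := by
      have : Module.Projective S (AddMonoidAlgebra S G) :=
        Module.Projective.of_equiv (AddMonoidAlgebra.coeffLinearEquiv S).symm
      exact (IsProjective.iff_projective _).1 inferInstance
    exact (hS'.hasProjectiveDimensionLT_X₃_iff d hp').1 h

theorem GlobalDimensionLE.addMonoidAlgebra {d : ℕ} (h : GlobalDimensionLE S d)
    (hG : ∀ (N : Type v) [AddCommGroup N] [Module S N] [Module (AddMonoidAlgebra S G) N]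
      [IsScalarTower S (AddMonoidAlgebra S G) N],
      Function.Exact (InducedModule.charMap G S N) (InducedModule.counit G S N)) :
    GlobalDimensionLE (AddMonoidAlgebra S G) (d + 1) := by
  intro M
  let : Module S M := Module.compHom M
    (AddMonoidAlgebra.singleZeroRingHom : S →+* AddMonoidAlgebra S G)
  have : IsScalarTower S (AddMonoidAlgebra S G) M := ⟨fun s a x => by
    change (s • a) • x = (AddMonoidAlgebra.singleZeroRingHom s : AddMonoidAlgebra S G) • a • x
    rw [← mul_smul]
    congr 1
    ext g
    exact (AddMonoidAlgebra.coeff_single_zero_mul a s g).symm⟩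
  exact hasProjectiveDimensionLT_addMonoidAlgebra hG d M (h _)

end

theorem GlobalDimensionLE.poly {S : Type v} [Ring S] {d : ℕ} (h : GlobalDimensionLE S d) :
    GlobalDimensionLE (AddMonoidAlgebra S ℕ) (d + 1) :=
  h.addMonoidAlgebra fun _ => exact_charMap_counit_nat

theorem GlobalDimensionLE.laurent {S : Type v} [Ring S] {d : ℕ} (h : GlobalDimensionLE S d) :
    GlobalDimensionLE (AddMonoidAlgebra S ℤ) (d + 1) :=
  h.addMonoidAlgebra fun _ => exact_charMap_counit_int

end NegativeK

end
noncomputable section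

namespace NegativeK

/-! ### Modules presented by idempotent matrices -/

section Represents

open scoped Matrix

variable {R : Type*} [Ring R] {m n : Type*} [Fintype m] [Fintype n]
  {P Q : Type*} [AddCommGroup P] [Module R P] [AddCommGroup Q] [Module R Q]

/-- The left module `P` is the image of the idempotent endomorphism `x ↦ x e` of `Rᵐ`. -/
def Represents (e : Matrix m m R) (P : Type*) [AddCommGroup P] [Module R P] : Prop :=
  ∃ (a : (m → R) →ₗ[R] P) (b : P →ₗ[R] (m → R)),
    a.comp b = LinearMap.id ∧ b.comp a = Matrix.vecMulLinear e

theorem Represents.of_equiv {e : Matrix m m R} (h : Represents e P) (σ : P ≃ₗ[R] Q) :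
    Represents e Q := by
  obtain ⟨a, b, hab, hba⟩ := h
  refine ⟨σ.toLinearMap.comp a, b.comp σ.symm.toLinearMap, ?_, ?_⟩
  · ext x
    simpa using congrArg σ (LinearMap.congr_fun hab (σ.symm x))
  · rw [← hba]
    ext x : 1
    simp

theorem Represents.prod {e : Matrix m m R} {f : Matrix n n R} (he : Represents e P)
    (hf : Represents f Q) : Represents (Matrix.fromBlocks e 0 0 f) (P × Q) := by
  obtain ⟨a, b, hab, hba⟩ := he
  obtain ⟨c, d, hcd, hdc⟩ := hf
  let σ := LinearEquiv.sumArrowLequivProdArrow m n R R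
  refine ⟨(a.prodMap c).comp σ.toLinearMap, σ.symm.toLinearMap.comp (b.prodMap d), ?_, ?_⟩
  · refine LinearMap.ext fun x => ?_
    simp only [LinearMap.comp_apply, LinearEquiv.coe_coe, LinearEquiv.apply_symm_apply]
    exact Prod.ext (LinearMap.congr_fun hab x.1) (LinearMap.congr_fun hcd x.2)
  · refine LinearMap.ext fun x => ?_
    have h1 := LinearMap.congr_fun hba (x ∘ Sum.inl)
    have h2 := LinearMap.congr_fun hdc (x ∘ Sum.inr)
    simp only [LinearMap.comp_apply, Matrix.vecMulLinear_apply] at h1 h2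
    rw [Matrix.vecMulLinear_apply, Matrix.vecMul_fromBlocks, Matrix.vecMul_zero,
      Matrix.vecMul_zero, add_zero, zero_add, ← h1, ← h2]
    funext i
    cases i <;> rfl

omit [Fintype n] in
theorem exists_vecMulLinear_eq [DecidableEq m] (A : (m → R) →ₗ[R] (n → R)) :
    ∃ u : Matrix m n R, Matrix.vecMulLinear u = A :=
  ⟨LinearMap.toMatrixRight' A, LinearEquiv.apply_symm_apply Matrix.toLinearMapRight' A⟩

omit [Fintype n] in
theorem vecMulLinear_injective [DecidableEq m] :
    Function.Injective (Matrix.vecMulLinear : Matrix m n R → _) :=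
  Matrix.toLinearMapRight'.injective

theorem vecMulLinear_mul {k : Type*} (u : Matrix m n R) (w : Matrix n k R) :
    Matrix.vecMulLinear (u * w) = (Matrix.vecMulLinear w).comp (Matrix.vecMulLinear u) :=
  LinearMap.ext fun x => (Matrix.vecMul_vecMul x u w).symm

/-- The composites `Rᵐ → P → Rⁿ` and `Rⁿ → P → Rᵐ` are given by matrices, and these realize the
equivalence. -/
theorem Represents.matrixEquivalent [DecidableEq m] [DecidableEq n] {e : Matrix m m R}
    {f : Matrix n n R} (he : Represents e P) (hf : Represents f P) : MatrixEquivalent e f := by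
  obtain ⟨a, b, hab, hba⟩ := he
  obtain ⟨c, d, hcd, hdc⟩ := hf
  obtain ⟨u, hu⟩ := exists_vecMulLinear_eq (d.comp a)
  obtain ⟨w, hw⟩ := exists_vecMulLinear_eq (b.comp c)
  refine ⟨u, w, vecMulLinear_injective ?_, vecMulLinear_injective ?_⟩
  · rw [vecMulLinear_mul, hu, hw, LinearMap.comp_assoc, ← LinearMap.comp_assoc a, hcd,
      LinearMap.id_comp, hba]
  · rw [vecMulLinear_mul, hu, hw, LinearMap.comp_assoc, ← LinearMap.comp_assoc c, hab,
      LinearMap.id_comp, hdc]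

theorem Represents.nonempty_equiv {e : Matrix m m R} (hP : Represents e P)
    (hQ : Represents e Q) : Nonempty (P ≃ₗ[R] Q) := by
  obtain ⟨a, b, hab, hba⟩ := hP
  obtain ⟨c, d, hcd, hdc⟩ := hQ
  refine ⟨LinearEquiv.ofLinearMap (c.comp b) (a.comp d) ?_ ?_⟩
  · rw [LinearMap.comp_assoc, ← LinearMap.comp_assoc d, hba, ← hdc, LinearMap.comp_assoc, hcd,
      LinearMap.comp_id, hcd]
  · rw [LinearMap.comp_assoc, ← LinearMap.comp_assoc b, hdc, ← hba, LinearMap.comp_assoc, hab,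
      LinearMap.comp_id, hab]

theorem represents_range {e : Matrix m m R} (he : IsIdempotentElem e) :
    Represents e (LinearMap.range (Matrix.vecMulLinear e)) := by
  refine ⟨(Matrix.vecMulLinear e).rangeRestrict, Submodule.subtype _, ?_, rfl⟩
  ext ⟨_, x, rfl⟩ : 2
  change (x ᵥ* e) ᵥ* e = x ᵥ* e
  rw [Matrix.vecMul_vecMul, he.eq]

theorem represents_one [DecidableEq m] : Represents (1 : Matrix m m R) (m → R) :=
  ⟨LinearMap.id, LinearMap.id, rfl, LinearMap.ext fun x => (Matrix.vecMul_one x).symm⟩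

end Represents

/-! ### Lattices -/

section Lattice

open scoped Matrix

variable {T L : Type v} [Ring T] [Ring L] (φ : T →+* L) (t : T)

/-- The ring `L` is obtained from `T` by inverting `t`. -/
structure IsOreInverse : Prop where
  injective : Function.Injective φ
  isUnit : IsUnit (φ t)
  exists_pow_mul : ∀ x : L, ∃ (n : ℕ) (y : T), φ y = φ t ^ n * x

/-- `M` is a `T`-lattice in the `L`-module `P`. -/
structure IsLattice {M P : Type*} [AddCommGroup M] [Module T M] [AddCommGroup P] [Module L P]
    (j : M →ₛₗ[φ] P) : Prop where
  injective : Function.Injective j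
  exists_pow_smul : ∀ x : P, ∃ (n : ℕ) (y : M), j y = φ t ^ n • x

/-- The inclusion of `Tᵐ` in `Lᵐ`. -/
def piMap (m : Type*) : (m → T) →ₛₗ[φ] (m → L) where
  toFun y := φ ∘ y
  map_add' _ _ := funext fun _ => map_add φ _ _
  map_smul' _ _ := funext fun _ => map_mul φ _ _

variable {φ t}

theorem IsOreInverse.smul_eq_zero (h : IsOreInverse φ t) {P : Type*} [AddCommGroup P] [Module L P]
    (n : ℕ) {x : P} : φ t ^ n • x = 0 ↔ x = 0 :=
  (h.isUnit.pow n).smul_eq_zero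

theorem IsOreInverse.isLattice_piMap (h : IsOreInverse φ t) (m : Type*) [Fintype m] :
    IsLattice φ t (piMap φ m) where
  injective := h.injective.comp_left
  exists_pow_smul x := by
    choose n y hy using fun i => h.exists_pow_mul (x i)
    -- The sum of the exponents serves as a common exponent for all coordinates.
    refine ⟨∑ i, n i, fun i => t ^ (∑ i, n i - n i) * y i, funext fun i => ?_⟩
    have hi : n i ≤ ∑ i, n i := Finset.single_le_sum (fun _ _ => Nat.zero_le _) (Finset.mem_univ i)
    change φ (t ^ (∑ i, n i - n i) * y i) = φ t ^ (∑ i, n i) * x i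
    rw [map_mul, hy, map_pow, ← mul_assoc, ← pow_add, Nat.sub_add_cancel hi]

variable (φ) in
/-- The lattice of integral vectors in a submodule of `Lᵐ`. -/
def integralVectors {m : Type*} (P : Submodule L (m → L)) : Submodule T (m → T) :=
  P.comap (piMap φ m)

variable (φ) in
/-- The inclusion of the lattice of integral vectors. -/
def integralVectorsMap {m : Type*} (P : Submodule L (m → L)) : integralVectors φ P →ₛₗ[φ] P where
  toFun y := ⟨piMap φ m y, y.2⟩
  map_add' y z := Subtype.ext (map_add (piMap φ m) (y : m → T) z)
  map_smul' c y := Subtype.ext (map_smulₛₗ (piMap φ m) c (y : m → T))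

theorem IsOreInverse.isLattice_integralVectorsMap (h : IsOreInverse φ t) {m : Type*} [Fintype m]
    (P : Submodule L (m → L)) : IsLattice φ t (integralVectorsMap φ P) where
  injective _ _ hyz := Subtype.ext ((h.isLattice_piMap m).injective (congrArg Subtype.val hyz))
  exists_pow_smul x := by
    obtain ⟨n, y, hy⟩ := (h.isLattice_piMap m).exists_pow_smul x
    exact ⟨n, ⟨y, show piMap φ m y ∈ P from hy ▸ P.smul_mem _ x.2⟩, Subtype.ext hy⟩

/-! ### Presentations of lattices by free modules. -/

section Presentation

variable {M P : Type*} [AddCommGroup M] [Module T M] [AddCommGroup P] [Module L P]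
  {m : Type*} [Fintype m] [DecidableEq m]

/-- The extension to `Lᵐ` of a homomorphism `Tᵐ → M`, for a lattice `M` in `P`. -/
def extend (j : M →ₛₗ[φ] P) (f : (m → T) →ₗ[T] M) : (m → L) →ₗ[L] P :=
  Fintype.linearCombination L fun i => j (f (Pi.single i 1))

theorem extend_piMap (j : M →ₛₗ[φ] P) (f : (m → T) →ₗ[T] M) (y : m → T) :
    extend j f (piMap φ m y) = j (f y) := by
  conv_rhs => rw [pi_eq_sum_univ' y]
  rw [map_sum, map_sum]
  refine Finset.sum_congr rfl fun i _ => ?_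
  rw [map_smul, map_smulₛₗ]
  congr

theorem extend_surjective (h : IsOreInverse φ t) {j : M →ₛₗ[φ] P} (hj : IsLattice φ t j)
    {f : (m → T) →ₗ[T] M} (hf : Function.Surjective f) : Function.Surjective (extend j f) := by
  intro x
  obtain ⟨n, y, hy⟩ := hj.exists_pow_smul x
  obtain ⟨z, rfl⟩ := hf y
  obtain ⟨c, hc⟩ := h.isUnit.pow n
  refine ⟨(↑c⁻¹ : L) • piMap φ m z, ?_⟩
  rw [map_smul, extend_piMap, hy, ← hc, smul_smul, Units.inv_mul, one_smul]

theorem extend_eq_zero_iff (h : IsOreInverse φ t) {j : M →ₛₗ[φ] P} (hj : IsLattice φ t j)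
    (f : (m → T) →ₗ[T] M) {x : m → L} {n : ℕ} {y : m → T} (hy : piMap φ m y = φ t ^ n • x) :
    extend j f x = 0 ↔ f y = 0 := by
  rw [← h.smul_eq_zero n, ← map_smul, ← hy, extend_piMap, map_eq_zero_iff _ hj.injective]

/-- Thus a syzygy of a lattice is again a lattice, in the kernel of the extended map, which keeps
the induction on projective dimension going. -/
theorem integralVectors_ker_extend {j : M →ₛₗ[φ] P} (hj : IsLattice φ t j)
    (f : (m → T) →ₗ[T] M) :
    integralVectors φ (LinearMap.ker (extend j f)) = LinearMap.ker f := by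
  ext y
  change extend j f (piMap φ m y) = 0 ↔ f y = 0
  rw [extend_piMap, map_eq_zero_iff _ hj.injective]

/-- A projective lattice is the image of an idempotent `q` over `T`, and `P` is its base change.
Instead of tensor products, the proof compares two quotients of `Lⁿ`: `P` and the image of `q.map
φ`. -/
theorem exists_represents_map (h : IsOreInverse φ t) {j : M →ₛₗ[φ] P} (hj : IsLattice φ t j)
    [Module.Finite T M] [Module.Projective T M] :
    ∃ (n : ℕ) (q : Matrix (Fin n) (Fin n) T), IsIdempotentElem q ∧ Represents (q.map φ) P := by
  obtain ⟨n, f, hf⟩ := Module.Finite.exists_fin' T M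
  obtain ⟨s, hs⟩ := Module.projective_lifting_property f LinearMap.id hf
  obtain ⟨q, hq⟩ := exists_vecMulLinear_eq (s.comp f)
  have hqi : IsIdempotentElem q := by
    apply vecMulLinear_injective
    rw [vecMulLinear_mul, hq, LinearMap.comp_assoc, ← LinearMap.comp_assoc f, hs,
      LinearMap.id_comp]
  have hqφ : ∀ y, piMap φ (Fin n) y ᵥ* q.map φ = piMap φ (Fin n) (s (f y)) := by
    intro y
    have := LinearMap.congr_fun hq y
    rw [LinearMap.comp_apply] at this
    rw [← this]
    funext i
    exact (RingHom.map_vecMul φ q y i).symm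
  -- After multiplication by a power of `t` the vector is integral, and there `s (f y) = 0` exactly
  -- when `f y = 0`, since `s` is a section.
  have hker : LinearMap.ker (extend j f) = LinearMap.ker (Matrix.vecMulLinear (q.map φ)) := by
    ext x
    obtain ⟨k, y, hy⟩ := (h.isLattice_piMap (Fin n)).exists_pow_smul x
    rw [LinearMap.mem_ker, LinearMap.mem_ker, extend_eq_zero_iff h hj f hy,
      ← h.smul_eq_zero k (x := Matrix.vecMulLinear (q.map φ) x), ← map_smul, ← hy,
      Matrix.vecMulLinear_apply, hqφ, map_eq_zero_iff _ (h.isLattice_piMap (Fin n)).injective]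
    refine ⟨fun h => by rw [h, map_zero], fun h => ?_⟩
    rw [← LinearMap.id_apply (R := T) (f y), ← hs, LinearMap.comp_apply, h, map_zero]
  have hqφi : IsIdempotentElem (q.map φ) := isIdempotentElem_map hqi φ
  refine ⟨n, q, hqi, (represents_range hqφi).of_equiv ?_⟩
  exact (LinearMap.quotKerEquivRange _).symm.trans ((Submodule.quotEquivOfEq _ _ hker.symm).trans
    (LinearMap.quotKerEquivOfSurjective _ (extend_surjective h hj hf)))

end Presentation

/-- The class of `P` is a difference of classes of projective modules extended from `T`. -/
def StablyExtended (φ : T →+* L) (P : Type*) [AddCommGroup P] [Module L P] : Prop :=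
  ∃ (m n : Type) (_ : Fintype m) (_ : DecidableEq m) (_ : Fintype n) (_ : DecidableEq n)
    (q : Matrix m m T) (q' : Matrix n n T), IsIdempotentElem q ∧ IsIdempotentElem q' ∧
    Represents (q'.map φ) (P × LinearMap.range (Matrix.vecMulLinear (q.map φ)))

/-- Induction on the projective dimension of the lattice. A projective lattice makes `P` itself
extended. Otherwise a cover `Tⁿ → M` extends to `Lⁿ → P`, which splits, so `[P] = [Lⁿ] - [K]`, where
the kernel `K` contains a lattice of smaller dimension. -/
theorem stablyExtended_of_isLattice [IsNoetherianRing T] (h : IsOreInverse φ t) (d : ℕ) :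
    ∀ (P : Type v) [AddCommGroup P] [Module L P] [Module.Projective L P]
      (M : Type v) [AddCommGroup M] [Module T M] [Module.Finite T M] (j : M →ₛₗ[φ] P),
      IsLattice φ t j → HasProjectiveDimensionLT (ModuleCat.of T M) (d + 1) →
      StablyExtended φ P := by
  induction d with
  | zero =>
    intro P _ _ _ M _ _ _ j hj hM
    rw [zero_add, ← projective_iff_hasProjectiveDimensionLT_one,
      ← IsProjective.iff_projective] at hM
    obtain ⟨n, q, hq, hqP⟩ := exists_represents_map h hj
    -- No complement is needed: the empty matrix presents the zero module.
    refine ⟨Empty, Fin n, inferInstance, inferInstance, inferInstance, inferInstance, 1, q,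
      IsIdempotentElem.one, hq, hqP.of_equiv ?_⟩
    have : Unique (LinearMap.range
        (Matrix.vecMulLinear ((1 : Matrix Empty Empty T).map φ))) :=
      { default := 0, uniq := fun x => Subtype.ext (Subsingleton.elim _ _) }
    exact LinearEquiv.prodUnique.symm
  | succ d ih =>
    intro P _ _ _ M _ _ _ j hj hM
    obtain ⟨n, f, hf⟩ := Module.Finite.exists_fin' T M
    have hS := LinearMap.shortExact_shortComplexKer hf
    have hp : Projective (ModuleCat.of T (Fin n → T)) :=
      (IsProjective.iff_projective _).1 inferInstance
    have hK := (hS.hasProjectiveDimensionLT_X₃_iff d hp).1 hM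
    obtain ⟨s, hs⟩ := Module.projective_lifting_property (extend j f) LinearMap.id
      (extend_surjective h hj hf)
    have σ : (LinearMap.ker (extend j f) × P) ≃ₗ[L] (Fin n → L) :=
      lequivProdOfRightSplitExact (LinearMap.ker (extend j f)).subtype_injective
        (Submodule.range_subtype _) hs
    have : Module.Projective L (LinearMap.ker (extend j f)) :=
      Module.Projective.of_split (σ.toLinearMap.comp (LinearMap.inl _ _ _))
        ((LinearMap.fst _ _ _).comp σ.symm.toLinearMap) (by ext x; simp)
    obtain ⟨m, k, _, _, _, _, q, q', hq, hq', hqq⟩ := ih (LinearMap.ker (extend j f))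
      (integralVectors φ (LinearMap.ker (extend j f))) (integralVectorsMap φ _)
      (h.isLattice_integralVectorsMap _) (by rw [integralVectors_ker_extend hj]; exact hK)
    -- The matrices for `K` change roles because `[K]` enters with a minus sign: from `K × im q ≅ im
    -- q'` follows `P × im q' ≅ Lⁿ × im q`.
    refine ⟨k, Fin n ⊕ m, inferInstance, inferInstance, inferInstance, inferInstance, q',
      Matrix.fromBlocks 1 0 0 q, hq', ?_, ?_⟩
    · exact isIdempotentElem_fromBlocks IsIdempotentElem.one hq
    · have hqφ : IsIdempotentElem (q.map φ) := isIdempotentElem_map hq φ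
      have hqφ' : IsIdempotentElem (q'.map φ) := isIdempotentElem_map hq' φ
      have h1 := represents_one.prod (represents_range hqφ) (m := Fin n)
      rw [Matrix.fromBlocks_map, Matrix.map_one φ (map_zero φ) (map_one φ),
        Matrix.map_zero _ (map_zero φ), Matrix.map_zero _ (map_zero φ)]
      obtain ⟨τ⟩ := hqq.nonempty_equiv (represents_range hqφ')
      refine h1.of_equiv ?_
      exact ((σ.symm.trans (LinearEquiv.prodComm L _ _)).prodCongr (LinearEquiv.refl L _)).trans
        ((LinearEquiv.prodAssoc L _ _ _).trans ((LinearEquiv.refl L P).prodCongr τ))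

/-- Over a noetherian ring `T` of finite global dimension, every idempotent of `L = T[t⁻¹]` is
stably equivalent to one that comes from `T`. -/
theorem exists_matrixEquivalent_fromBlocks [IsNoetherianRing T] (h : IsOreInverse φ t) {d : ℕ}
    (hd : GlobalDimensionLE T d) {p : Matrix Unit Unit L} (hp : IsIdempotentElem p) :
    ∃ (m n : Type) (_ : Fintype m) (_ : DecidableEq m) (_ : Fintype n) (_ : DecidableEq n)
      (q : Matrix m m T) (q' : Matrix n n T), IsIdempotentElem q ∧ IsIdempotentElem q' ∧
      MatrixEquivalent (Matrix.fromBlocks p 0 0 (q.map φ)) (q'.map φ) := by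
  have hpr := represents_range hp
  have : Module.Projective L (LinearMap.range (Matrix.vecMulLinear p)) := by
    obtain ⟨a, b, hab, -⟩ := hpr
    exact Module.Projective.of_split b a hab
  obtain ⟨m, n, _, _, _, _, q, q', hq, hq', hqq⟩ := stablyExtended_of_isLattice h d
    (LinearMap.range (Matrix.vecMulLinear p))
    (integralVectors φ (LinearMap.range (Matrix.vecMulLinear p))) (integralVectorsMap φ _)
    (h.isLattice_integralVectorsMap _) (hd _)
  have hqφ : IsIdempotentElem (q.map φ) := isIdempotentElem_map hq φ
  exact ⟨m, n, inferInstance, inferInstance, inferInstance, inferInstance, q, q', hq, hq',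
    (hpr.prod (represents_range hqφ)).matrixEquivalent hqq⟩

end Lattice

end NegativeK

end
noncomputable section

namespace NegativeK

/-! ### Rings that are regular up to a nilpotent ideal -/

theorem isNilpotent_of_injective {R S : Type*} [Ring R] [Ring S] (f : R →+* S)
    (hf : Function.Injective f) {I : Ideal R} {J : Ideal S} (hIJ : ∀ x ∈ I, f x ∈ J)
    (hJ : IsNilpotent J) : IsNilpotent I := by
  obtain ⟨N, hN⟩ := hJ
  have key : ∀ i : ℕ, ∀ x ∈ I ^ (i + 1), f x ∈ J ^ (i + 1) := by
    intro i
    induction i with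
    | zero => simpa only [zero_add, Submodule.pow_one] using hIJ
    | succ i ih =>
      intro x hx
      rw [Submodule.pow_succ] at hx ⊢
      induction hx using Submodule.mul_induction_on' with
      | mem_mul_mem a ha b hb =>
        rw [map_mul]
        exact Ideal.mul_mem_mul (ih a ha) (hIJ b hb)
      | add a _ b _ ha hb =>
        rw [map_add]
        exact Ideal.add_mem _ ha hb
  refine ⟨N + 1, ?_⟩
  rw [Submodule.zero_eq_bot, eq_bot_iff]
  intro x hx
  have h := key N x hx
  rw [Submodule.pow_succ, hN, Submodule.zero_eq_bot, Submodule.bot_mul] at h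
  exact (map_eq_zero_iff f hf).1 h

theorem isNilpotent_comap_op {R : Type*} [Ring R] {J : Ideal Rᵐᵒᵖ} {I : Ideal R}
    (hIJ : ∀ x ∈ I, MulOpposite.op x ∈ J) (hJ : IsNilpotent J) : IsNilpotent I := by
  obtain ⟨N, hN⟩ := hJ
  have key : ∀ i : ℕ, ∀ x ∈ I ^ (i + 1), MulOpposite.op x ∈ J ^ (i + 1) := by
    intro i
    induction i with
    | zero => simpa only [zero_add, Submodule.pow_one] using hIJ
    | succ i ih =>
      intro x hx
      rw [Submodule.pow_succ] at hx
      -- `op` reverses products, so a factor split off on the right in `R` appears on the left in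
      -- `Rᵐᵒᵖ`.
      rw [Submodule.pow_succ' _ (Nat.succ_ne_zero i)]
      induction hx using Submodule.mul_induction_on' with
      | mem_mul_mem a ha b hb =>
        rw [MulOpposite.op_mul]
        exact Ideal.mul_mem_mul (hIJ b hb) (ih a ha)
      | add a _ b _ ha hb =>
        rw [MulOpposite.op_add]
        exact Ideal.add_mem _ ha hb
  refine ⟨N + 1, ?_⟩
  rw [Submodule.zero_eq_bot, eq_bot_iff]
  intro x hx
  have h := key N x hx
  rw [Submodule.pow_succ, hN, Submodule.zero_eq_bot, Submodule.bot_mul] at h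
  exact (MulOpposite.op_eq_zero_iff x).1 h

/-- A ring that has a nilpotent ideal with left noetherian quotient of finite left global
dimension. -/
def NilRegular (S : Type v) [Ring S] : Prop :=
  ∃ (S' : Type v) (_ : Ring S') (ψ : S →+* S') (d : ℕ), Function.Surjective ψ ∧
    IsNilpotent (RingHom.ker ψ) ∧ IsNoetherianRing S' ∧ GlobalDimensionLE S' d

theorem NilRegular.of_ringEquiv {R S : Type v} [Ring R] [Ring S] (e : R ≃+* S)
    (h : NilRegular S) : NilRegular R := by
  obtain ⟨S', _, ψ, d, hs, hn, hN, hd⟩ := h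
  exact ⟨S', _, ψ.comp e.toRingHom, d, hs.comp e.surjective,
    isNilpotent_of_injective e.toRingHom e.injective (fun _ hx => hx) hn, hN, hd⟩

theorem nilRegular_of_isArtinianRing (R : Type v) [Ring R] [IsArtinianRing R] : NilRegular R := by
  refine ⟨R ⧸ Ring.jacobson R, inferInstance, Ideal.Quotient.mk _, 0, Ideal.Quotient.mk_surjective,
    ?_, inferInstance, globalDimensionLE_zero _⟩
  rw [Ideal.mk_ker]
  exact IsSemiprimaryRing.isNilpotent

/-- Semisimplicity is left-right symmetric, so the opposite of the semisimple quotient of `Rᵐᵒᵖ` is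
a semisimple quotient of `R` with nilpotent kernel. -/
theorem nilRegular_of_isArtinianRing_op (R : Type v) [Ring R] [IsArtinianRing Rᵐᵒᵖ] :
    NilRegular R := by
  refine ⟨(Rᵐᵒᵖ ⧸ Ring.jacobson Rᵐᵒᵖ)ᵐᵒᵖ, inferInstance,
    (RingHom.op (Ideal.Quotient.mk (Ring.jacobson Rᵐᵒᵖ))).comp (RingEquiv.opOp R).toRingHom, 0,
    ?_, ?_, inferInstance, globalDimensionLE_zero _⟩
  · intro x
    obtain ⟨y, hy⟩ := Ideal.Quotient.mk_surjective x.unop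
    exact ⟨y.unop, congrArg MulOpposite.op hy⟩
  · refine isNilpotent_comap_op (fun x hx => ?_)
      (IsSemiprimaryRing.isNilpotent : IsNilpotent (Ring.jacobson Rᵐᵒᵖ))
    exact Ideal.Quotient.eq_zero_iff_mem.1 (congrArg MulOpposite.unop (RingHom.mem_ker.1 hx))

theorem surjective_mapRingHom {R S : Type*} [Ring R] [Ring S] (M : Type*) [AddMonoid M]
    {ψ : R →+* S} (h : Function.Surjective ψ) :
    Function.Surjective (AddMonoidAlgebra.mapRingHom M ψ) :=
  AddMonoidAlgebra.map_surjective ψ.toAddMonoidHom h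

theorem NilRegular.laurent {S : Type v} [Ring S] (h : NilRegular S) :
    NilRegular (AddMonoidAlgebra S ℤ) := by
  obtain ⟨S', _, ψ, d, hs, hn, hN, hd⟩ := h
  exact ⟨AddMonoidAlgebra S' ℤ, inferInstance, AddMonoidAlgebra.mapRingHom ℤ ψ, d + 1,
    surjective_mapRingHom ℤ hs, isNilpotent_ker_mapRingHom ℤ ψ hn, inferInstance, hd.laurent⟩

theorem isOreInverse_polyToLaurent (S : Type v) [Ring S] :
    IsOreInverse (polyToLaurent S) (AddMonoidAlgebra.single 1 1) where
  injective := polyToLaurent_injective S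
  isUnit := by
    rw [polyToLaurent_single]
    exact isUnit_single S _
  exists_pow_mul x := by
    obtain ⟨n, y, h⟩ := exists_single_mul_mem_range S x
    refine ⟨n, y, ?_⟩
    rw [h, polyToLaurent_single, AddMonoidAlgebra.single_pow, one_pow]
    simp

theorem mapRingHom_polyToLaurent {R S : Type*} [Ring R] [Ring S] (ψ : R →+* S)
    (x : AddMonoidAlgebra R ℕ) :
    AddMonoidAlgebra.mapRingHom ℤ ψ (polyToLaurent R x) =
      polyToLaurent S (AddMonoidAlgebra.mapRingHom ℕ ψ x) := by
  induction x using AddMonoidAlgebra.induction_linear with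
  | zero => simp only [map_zero]
  | add x y hx hy => simp only [map_add, hx, hy]
  | single n r =>
    rw [polyToLaurent_single, AddMonoidAlgebra.mapRingHom_single,
      AddMonoidAlgebra.mapRingHom_single, polyToLaurent_single]

/-- The regular case applies over `S'`. The resulting idempotents lift along `S[t] → S'[t]`, the
equivalence along `S[t, t⁻¹] → S'[t, t⁻¹]`; both kernels are nilpotent. -/
theorem NilRegular.exists_matrixEquivalent {S : Type v} [Ring S] (h : NilRegular S)
    {p : Matrix Unit Unit (AddMonoidAlgebra S ℤ)} (hp : IsIdempotentElem p) :
    ∃ (m n : Type) (_ : Fintype m) (_ : DecidableEq m) (_ : Fintype n) (_ : DecidableEq n)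
      (q : Matrix m m (AddMonoidAlgebra S ℕ)) (q' : Matrix n n (AddMonoidAlgebra S ℕ)),
      IsIdempotentElem q ∧ IsIdempotentElem q' ∧
      MatrixEquivalent (Matrix.fromBlocks p 0 0 (q.map (polyToLaurent S)))
        (q'.map (polyToLaurent S)) := by
  obtain ⟨S', _, ψ, d, hs, hn, hN, hd⟩ := h
  let ψN := AddMonoidAlgebra.mapRingHom ℕ ψ
  let ψZ := AddMonoidAlgebra.mapRingHom ℤ ψ
  obtain ⟨m, n, _, _, _, _, q, q', hq, hq', h⟩ := exists_matrixEquivalent_fromBlocks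
    (isOreInverse_polyToLaurent S') hd.poly (isIdempotentElem_map hp ψZ)
  obtain ⟨r, hr, rfl⟩ := exists_isIdempotentElem_map_eq ψN (surjective_mapRingHom ℕ hs)
    (isNilpotent_ker_mapRingHom ℕ ψ hn) q hq
  obtain ⟨r', hr', rfl⟩ := exists_isIdempotentElem_map_eq ψN (surjective_mapRingHom ℕ hs)
    (isNilpotent_ker_mapRingHom ℕ ψ hn) q' hq'
  refine ⟨m, n, inferInstance, inferInstance, inferInstance, inferInstance, r, r', hr, hr', ?_⟩
  have hmap : ∀ {k : Type} (w : Matrix k k (AddMonoidAlgebra S ℕ)),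
      (w.map (polyToLaurent S)).map ψZ = (w.map ψN).map (polyToLaurent S') := fun w =>
    Matrix.ext fun _ _ => mapRingHom_polyToLaurent ψ _
  refine MatrixEquivalent.of_map (isIdempotentElem_fromBlocks hp (isIdempotentElem_map hr _))
    (isIdempotentElem_map hr' _) ψZ (surjective_mapRingHom ℤ hs)
    (isNilpotent_ker_mapRingHom ℤ ψ hn) ?_
  rw [Matrix.fromBlocks_map, Matrix.map_zero _ (map_zero ψZ), Matrix.map_zero _ (map_zero ψZ),
    hmap, hmap]
  exact h

end NegativeK

end
noncomputable section

namespace NegativeK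

/-! ### Objects presented by idempotent matrices -/

section Realizes

universe v₁ v₂ u₁ u₂ v₃ u₃ v₄ u₄

variable {C : Type u₁} [Category.{v₁} C] [Preadditive C] {D : Type u₂} [Category.{v₂} D]
  [Preadditive D] (G : C ⥤ D) [G.Additive] {X : C} {m n k : Type} [Fintype m] [Fintype n]
  [Fintype k] {P Q W : D}

/-- The object `P` is the image of the endomorphism `G e` of `(G X)ᵐ`. The matrix `e` acts on
column vectors, as composition in `End X` is that of functions. -/
structure Realization (e : Matrix m m (End X)) (P : D) where
  /-- the components of the projection -/
  proj : m → (G.obj X ⟶ P)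
  /-- the components of the inclusion -/
  incl : m → (P ⟶ G.obj X)
  total : ∑ i, incl i ≫ proj i = 𝟙 P
  proj_incl : ∀ i j, proj i ≫ incl j = G.map (e j i)

variable {G}

namespace Realization

variable {e : Matrix m m (End X)} {f : Matrix n n (End X)} {g : Matrix k k (End X)}

omit [Fintype m] [Fintype k] in
theorem map_mul_apply (u : Matrix m n (End X)) (w : Matrix n k (End X)) (i : m) (j : k) :
    G.map ((u * w) i j) = ∑ l, G.map (w l j) ≫ G.map (u i l) := by
  rw [Matrix.mul_apply]
  refine (G.map_sum _ _).trans (Finset.sum_congr rfl fun l _ => ?_)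
  exact G.map_comp (w l j) (u i l)

/-- The morphism with a given matrix. -/
def hom (r : Realization G e P) (s : Realization G f Q) (u : Matrix n m (End X)) : P ⟶ Q :=
  ∑ i, ∑ j, r.incl i ≫ G.map (u j i) ≫ s.proj j

/-- The middle factor `f` comes from projecting to `Q` and including again. -/
theorem hom_comp_hom (r : Realization G e P) (s : Realization G f Q) (t : Realization G g W)
    (u : Matrix n m (End X)) (w : Matrix k n (End X)) :
    r.hom s u ≫ s.hom t w = r.hom t (w * (f * u)) := by
  simp only [hom, Preadditive.sum_comp, Preadditive.comp_sum, map_mul_apply, Category.assoc]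
  refine (Finset.sum_congr rfl fun _ _ => Finset.sum_comm).trans (Finset.sum_comm.trans
    (Finset.sum_congr rfl fun _ _ => Finset.sum_comm.trans (Finset.sum_congr rfl fun _ _ =>
      Finset.sum_congr rfl fun _ _ => Finset.sum_congr rfl fun _ _ => ?_)))
  rw [← s.proj_incl, Category.assoc]

omit [Preadditive C] [G.Additive] in
theorem hom_self (r : Realization G e P) : r.hom r e = 𝟙 P := by
  simp only [hom, ← r.proj_incl]
  rw [← Category.comp_id (𝟙 P)]
  nth_rw 1 [← r.total]
  rw [← r.total]
  simp only [Preadditive.sum_comp, Preadditive.comp_sum, Category.assoc]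
  exact Finset.sum_comm

theorem proj_hom_incl (r : Realization G e P) (s : Realization G f Q) (u : Matrix n m (End X))
    (i : m) (j : n) : r.proj i ≫ r.hom s u ≫ s.incl j = G.map ((f * (u * e)) j i) := by
  simp only [hom, Preadditive.sum_comp, Preadditive.comp_sum, map_mul_apply, Category.assoc,
    s.proj_incl, ← r.proj_incl]
  rw [Finset.sum_comm]

theorem nonempty_iso (r : Realization G e P) (s : Realization G f Q) (he : IsIdempotentElem e)
    (hf : IsIdempotentElem f) (h : MatrixEquivalent e f) : Nonempty (P ≅ Q) := by
  obtain ⟨u, w, huw, hwu⟩ := h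
  refine ⟨⟨r.hom s w, s.hom r u, ?_, ?_⟩⟩
  · rw [hom_comp_hom, ← hwu, Matrix.mul_assoc, huw, ← Matrix.mul_assoc, huw, he.eq, hom_self]
  · rw [hom_comp_hom, ← huw, Matrix.mul_assoc, hwu, ← Matrix.mul_assoc, hwu, hf.eq, hom_self]

/-- The biproduct of the objects presented by two matrices is presented by their block sum. -/
def biprod [HasBinaryBiproducts D] (r : Realization G e P) (s : Realization G f Q) :
    Realization G (Matrix.fromBlocks e 0 0 f) (P ⊞ Q) where
  proj := Sum.elim (fun i => r.proj i ≫ biprod.inl) (fun i => s.proj i ≫ biprod.inr)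
  incl := Sum.elim (fun i => biprod.fst ≫ r.incl i) (fun i => biprod.snd ≫ s.incl i)
  total := by
    have h1 := congrArg (fun x => (biprod.fst : P ⊞ Q ⟶ P) ≫ x ≫ (biprod.inl : P ⟶ P ⊞ Q)) r.total
    have h2 := congrArg (fun x => (biprod.snd : P ⊞ Q ⟶ Q) ≫ x ≫ (biprod.inr : Q ⟶ P ⊞ Q)) s.total
    simp only [Preadditive.sum_comp, Preadditive.comp_sum, Category.assoc, Category.id_comp]
      at h1 h2
    simp only [Fintype.sum_sum_type, Sum.elim_inl, Sum.elim_inr, Category.assoc, h1, h2,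
      biprod.total]
  proj_incl := by
    rintro (i | i) (j | j)
    · simp [r.proj_incl]
    · simp
    · simp
    · simp [s.proj_incl]

variable (G X m) in
/-- A finite power of `G X` is presented by the identity matrix. -/
def power [DecidableEq m] [HasFiniteBiproducts D] :
    Realization G (1 : Matrix m m (End X)) (⨁ fun _ : m => G.obj X) where
  proj i := biproduct.ι (fun _ : m => G.obj X) i
  incl i := biproduct.π (fun _ : m => G.obj X) i
  total := biproduct.total
  proj_incl i j := by
    by_cases h : i = j
    · subst h
      rw [biproduct.ι_π_self, Matrix.one_apply_eq]
      exact (G.map_id X).symm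
    · rw [biproduct.ι_π_ne _ h, Matrix.one_apply_ne (Ne.symm h)]
      exact (G.map_zero X X).symm

variable (G) in
-- The matrix acts as an idempotent on a finite power of `G X`, and splitting it gives `P`.
theorem exists_realization [DecidableEq m] [HasFiniteBiproducts D] [IsIdempotentComplete D]
    (he : IsIdempotentElem e) : ∃ P : D, Nonempty (Realization G e P) := by
  let r := power G X m
  obtain ⟨P, i, p, hip, hpi⟩ := IsIdempotentComplete.idempotents_split _ (r.hom r e) (by
    rw [hom_comp_hom, one_mul, he.eq])
  refine ⟨P, ⟨⟨fun j => r.proj j ≫ p, fun j => i ≫ r.incl j, ?_, fun j l => ?_⟩⟩⟩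
  · have := congrArg (fun x => i ≫ x ≫ p) r.total
    simpa [Preadditive.sum_comp, Preadditive.comp_sum, hip] using this
  · rw [Category.assoc, reassoc_of% hpi, proj_hom_incl, one_mul, mul_one]

/-- The image of a realization under a functor. -/
def mapFunctor {C' : Type u₃} [Category.{v₃} C'] [Preadditive C'] {D' : Type u₄}
    [Category.{v₄} D'] [Preadditive D'] {G' : C' ⥤ D'} [G'.Additive] (F : D ⥤ D') [F.Additive]
    (H : C ⥤ C') (θ : G ⋙ F ≅ H ⋙ G') (r : Realization G e P) :
    Realization G' (e.map fun x => (H.map x : End (H.obj X))) (F.obj P) where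
  proj i := θ.inv.app X ≫ F.map (r.proj i)
  incl i := F.map (r.incl i) ≫ θ.hom.app X
  total := by
    simp only [Category.assoc, Iso.hom_inv_id_app_assoc, ← F.map_comp, ← F.map_sum, r.total,
      F.map_id]
  proj_incl i j := by
    have := θ.hom.naturality (e j i)
    simp only [Functor.comp_map] at this
    rw [Category.assoc, ← F.map_comp_assoc, r.proj_incl, this, Iso.inv_hom_id_app_assoc]
    rfl

/-- An object of the idempotent completion is presented by its idempotent. -/
def ofKaroubi (P : Karoubi C) :
    Realization (toKaroubi C) (Matrix.of fun _ _ : Unit => (P.p : End P.X)) P where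
  proj _ := P.decompId_p
  incl _ := P.decompId_i
  total := by simp
  proj_incl _ _ := P.decomp_p.symm

end Realization

end Realizes

end NegativeK

end
noncomputable section

namespace NegativeK

/-! ### The Grothendieck group -/

section GrothendieckGroup

variable {C : Type u} [Category.{v} C] [Preadditive C]

theorem SplitK₀.mk_eq_of_iso {X Y : C} (e : X ≅ Y) : SplitK₀.mk X = SplitK₀.mk Y :=
  congrArg (fun x => QuotientAddGroup.mk (FreeAbelianGroup.of x)) (Quotient.sound ⟨e⟩)

theorem SplitK₀.mk_biprod [HasBinaryBiproducts C] (X Y : C) :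
    SplitK₀.mk (X ⊞ Y) = SplitK₀.mk X + SplitK₀.mk Y := by
  let S : ShortComplex C := ShortComplex.mk (biprod.inl : X ⟶ X ⊞ Y) biprod.snd (by simp)
  have s : S.Splitting :=
    { r := biprod.fst
      s := biprod.inr
      f_r := by simp [S]
      s_g := by simp [S]
      id := biprod.total }
  have h : isoClass X - isoClass (X ⊞ Y) + isoClass Y ∈ splitRelations C :=
    AddSubgroup.subset_closure ⟨S, ⟨s⟩, rfl⟩
  have h2 : SplitK₀.mk X - SplitK₀.mk (X ⊞ Y) + SplitK₀.mk Y = 0 :=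
    (QuotientAddGroup.eq_zero_iff (N := splitRelations C) _).2 h
  rw [sub_add_eq_add_sub, sub_eq_zero] at h2
  exact h2.symm

/-- Every class of an object of `D` is a difference of classes from `C`, so `SplitK₀.map F` is an
epimorphism. -/
theorem SplitK₀.hom_ext_of_exists {D : Type u} [Category.{v} D] [Preadditive D] (F : C ⥤ D)
    [F.Additive] (hF : ∀ P : D, ∃ Q Q' : C,
      SplitK₀.mk P + SplitK₀.mk (F.obj Q) = SplitK₀.mk (F.obj Q'))
    {A : Type*} [AddCommGroup A] {f g : SplitK₀ D →+ A}
    (h : f.comp (SplitK₀.map F) = g.comp (SplitK₀.map F)) : f = g := by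
  have key : ∀ Q : C, f (SplitK₀.mk (F.obj Q)) = g (SplitK₀.mk (F.obj Q)) := fun Q => by
    rw [← SplitK₀.map_mk]
    exact DFunLike.congr_fun h _
  refine SplitK₀.hom_ext fun P => ?_
  obtain ⟨Q, Q', hQ⟩ := hF P
  have h1 := congrArg f hQ
  rw [map_add, key, key, ← hQ, map_add] at h1
  exact add_right_cancel h1

end GrothendieckGroup

/-! ### Endomorphism rings in an extension -/

section EndExtension

variable {C : Type u} [Category.{v} C] [Preadditive C]

/-- The endomorphism ring of an object of `C[M]` is a monoid ring. -/
def endExtensionEquiv (M : Type) [AddCommMonoid M] (X : Extension M C) :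
    AddMonoidAlgebra (End X.as) M ≃+* End X where
  toFun x := (x.coeff : M →₀ End X.as)
  invFun x := AddMonoidAlgebra.ofCoeff (show M →₀ End X.as from x)
  left_inv _ := rfl
  right_inv _ := rfl
  map_add' _ _ := rfl
  map_mul' x y := by
    -- The factors are interchanged because the product in `End` is composition in the order of
    -- functions. Commutativity of `M` absorbs the interchange of exponents.
    change (x * y).coeff = Extension.conv (show M →₀ (X.as ⟶ X.as) from y.coeff)
      (show M →₀ (X.as ⟶ X.as) from x.coeff)
    induction x using AddMonoidAlgebra.induction_linear with
    | zero =>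
      rw [zero_mul]
      exact (map_zero (Extension.conv (show M →₀ (X.as ⟶ X.as) from y.coeff))).symm
    | add x x' hx hx' =>
      rw [add_mul]
      exact (congrArg₂ (· + ·) hx hx').trans (Extension.conv_add _ _ _).symm
    | single a r =>
      induction y using AddMonoidAlgebra.induction_linear with
      | zero =>
        rw [mul_zero]
        exact (DFunLike.congr_fun (map_zero (Extension.conv (M := M) (X := X.as) (Y := X.as)
          (Z := X.as))) _).symm
      | add y y' hy hy' =>
        rw [mul_add]
        exact (congrArg₂ (· + ·) hy hy').trans (Extension.add_conv _ _ _).symm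
      | single b s =>
        rw [AddMonoidAlgebra.single_mul_single, add_comm]
        exact (Extension.conv_single b a s r).symm

/-- Endomorphisms in `C[t]` as endomorphisms in `C[t, t⁻¹]`. -/
theorem map_endExtensionEquiv (X : C) (x : AddMonoidAlgebra (End X) ℕ) :
    (Extension.map (𝟭 C) (Nat.castAddMonoidHom ℤ)).map
        (endExtensionEquiv ℕ (Extension.of X) x) =
      endExtensionEquiv ℤ (Extension.of X) (polyToLaurent (End X) x) := by
  induction x using AddMonoidAlgebra.induction_linear with
  | zero =>
    rw [map_zero, map_zero, map_zero]
    exact Functor.map_zero _ _ _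
  | add x y hx hy =>
    rw [map_add, map_add, map_add, ← hx, ← hy]
    exact Functor.map_add _
  | single n r =>
    rw [polyToLaurent_single]
    exact Extension.mapHom_single (𝟭 C) (Nat.castAddMonoidHom ℤ) n r

/-- The functor induced on idempotent completions extends the given functor. -/
def toKaroubiCompIso {D : Type u} [Category.{v} D] (F : C ⥤ D) :
    toKaroubi C ⋙ karoubiMap F ≅ F ⋙ toKaroubi D :=
  NatIso.ofComponents (fun X =>
    { hom := ⟨𝟙 _, by simp [karoubiMap]⟩
      inv := ⟨𝟙 _, by simp [karoubiMap]⟩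
      hom_inv_id := by ext; simp [karoubiMap]
      inv_hom_id := by ext; simp [karoubiMap] }) (fun f => by ext; simp [karoubiMap])

end EndExtension

/-! ### Surjectivity of `K₀(C[t]) → K₀(C[t, t⁻¹])` -/

/-- All endomorphism rings are regular up to a nilpotent ideal. -/
def LocallyNilRegular (C : AdditiveCat.{v, u}) : Prop :=
  ∀ X : C.carrier, NilRegular (End X)

theorem NilRegular.end_extension {C : Type u} [Category.{v} C] [Preadditive C]
    (X : Extension ℤ C) (h : NilRegular (End X.as)) : NilRegular (End X) :=
  h.laurent.of_ringEquiv (endExtensionEquiv ℤ X).symm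

theorem LocallyNilRegular.laurent {C : AdditiveCat.{v, u}} (h : LocallyNilRegular C) :
    LocallyNilRegular ((extension ℤ).obj C) := fun X =>
  NilRegular.end_extension (C := C.carrier) X (h (Extension.as X))

/-- The stable equivalence of idempotent matrices over `S[t, t⁻¹]`, `S = End P.X.as`, read as an
isomorphism between `P` plus an object from `C[t]` and another object from `C[t]`. -/
theorem exists_mk_add_map_eq_map {C : Type u} [Category.{v} C] [Preadditive C]
    [HasFiniteBiproducts C] (P : Karoubi (Extension ℤ C)) (h : NilRegular (End P.X.as)) :
    ∃ Q Q' : Karoubi (Extension ℕ C), SplitK₀.mk P +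
      SplitK₀.mk ((karoubiMap (Extension.map (𝟭 C) (Nat.castAddMonoidHom ℤ))).obj Q) =
      SplitK₀.mk ((karoubiMap (Extension.map (𝟭 C) (Nat.castAddMonoidHom ℤ))).obj Q') := by
  let H := Extension.map (𝟭 C) (Nat.castAddMonoidHom ℤ)
  let εN := endExtensionEquiv ℕ (Extension.of P.X.as : Extension ℕ C)
  let εZ := endExtensionEquiv ℤ P.X
  let p : Matrix Unit Unit (End P.X) := Matrix.of fun _ _ => P.p
  have hp : IsIdempotentElem p := by
    ext
    simp [p, Matrix.mul_apply]
  obtain ⟨m, n, _, _, _, _, q, q', hq, hq', heq⟩ := h.exists_matrixEquivalent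
    (isIdempotentElem_map hp εZ.symm.toRingHom)
  have hqε : IsIdempotentElem (q.map εN) := isIdempotentElem_map hq εN.toRingHom
  have hqε' : IsIdempotentElem (q'.map εN) := isIdempotentElem_map hq' εN.toRingHom
  obtain ⟨Q, ⟨r⟩⟩ := Realization.exists_realization (toKaroubi (Extension ℕ C)) hqε
  obtain ⟨Q', ⟨r'⟩⟩ := Realization.exists_realization (toKaroubi (Extension ℕ C)) hqε'
  refine ⟨Q, Q', ?_⟩
  have hmap : ∀ {k : Type} (w : Matrix k k (AddMonoidAlgebra (End P.X.as) ℕ)),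
      ((w.map εN).map fun x => (H.map x : End (H.obj _))) =
        (w.map (polyToLaurent (End P.X.as))).map εZ := fun w =>
    Matrix.ext fun _ _ => map_endExtensionEquiv P.X.as _
  have s := r.mapFunctor (karoubiMap H) H (toKaroubiCompIso H)
  have s' := r'.mapFunctor (karoubiMap H) H (toKaroubiCompIso H)
  rw [hmap] at s s'
  have : HasBinaryBiproducts (Karoubi (Extension ℤ C)) := hasBinaryBiproducts_of_finite_biproducts _
  have t := (Realization.ofKaroubi P).biprod s
  have hqZ : IsIdempotentElem ((q.map (polyToLaurent (End P.X.as))).map εZ) :=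
    isIdempotentElem_map (isIdempotentElem_map hq _) εZ.toRingHom
  have hqZ' : IsIdempotentElem ((q'.map (polyToLaurent (End P.X.as))).map εZ) :=
    isIdempotentElem_map (isIdempotentElem_map hq' _) εZ.toRingHom
  have hpp : (p.map εZ.symm).map εZ = p := Matrix.ext fun _ _ => εZ.apply_symm_apply _
  have heqZ := heq.map εZ.toRingHom
  rw [Matrix.fromBlocks_map, Matrix.map_zero _ (map_zero _), Matrix.map_zero _ (map_zero _)] at heqZ
  change MatrixEquivalent (Matrix.fromBlocks ((p.map εZ.symm).map εZ) 0 0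
    ((q.map (polyToLaurent (End P.X.as))).map εZ))
    ((q'.map (polyToLaurent (End P.X.as))).map εZ) at heqZ
  rw [hpp] at heqZ
  obtain ⟨i⟩ := t.nonempty_iso s' (isIdempotentElem_fromBlocks hp hqZ) hqZ' heqZ
  rw [← SplitK₀.mk_biprod]
  exact SplitK₀.mk_eq_of_iso i

theorem epi_map_polyInclusion {C : AdditiveCat.{v, u}} (h : LocallyNilRegular C) :
    Epi (K₀.map (polyInclusion.app C)) := by
  refine ⟨fun f g hfg => ?_⟩
  ext1
  exact SplitK₀.hom_ext_of_exists
    (karoubiMap (Extension.map (𝟭 C.carrier) (Nat.castAddMonoidHom ℤ)))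
    (fun P => exists_mk_add_map_eq_map P (h P.X.as)) (congrArg AddCommGrpCat.Hom.hom hfg)

/-! ### Vanishing of contractions -/

universe w

theorem isZero_contraction_of_epi (F : AdditiveCat.{v, u} ⥤ AddCommGrpCat.{w})
    (C : AdditiveCat.{v, u}) [Epi (F.map (polyInclusion.app C))] :
    IsZero ((contraction F).obj C) := by
  let α := biprod.desc (Functor.whiskerRight polyInclusion F)
    (Functor.whiskerRight polyInvInclusion F)
  have h1 : Functor.whiskerRight polyInclusion F ≫ cokernel.π α = 0 := by
    rw [← biprod.inl_desc (Functor.whiskerRight polyInclusion F)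
      (Functor.whiskerRight polyInvInclusion F), Category.assoc]
    exact (congrArg (biprod.inl ≫ ·) (cokernel.condition α)).trans comp_zero
  have h2 : F.map (polyInclusion.app C) ≫ (cokernel.π α).app C = 0 := NatTrans.congr_app h1 C
  have h3 : (cokernel.π α).app C = 0 := (cancel_epi _).1 (h2.trans comp_zero.symm)
  -- The cokernel is formed in the functor category, where epimorphisms are pointwise.
  exact @IsZero.of_epi_eq_zero _ _ _ _ _ ((cokernel.π α).app C)
    ((NatTrans.epi_iff_epi_app _).1 inferInstance C) h3

/-- If `F` vanishes on a class closed under Laurent extension, then `F(C[t, t⁻¹]) = 0`, so the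
contraction vanishes there too. The statement is for all `F` because the induction replaces `F` by
its contraction. -/
theorem isZero_iterate_contraction (P : AdditiveCat.{v, u} → Prop)
    (hP : ∀ C, P C → P ((extension ℤ).obj C)) (n : ℕ) :
    ∀ F : AdditiveCat.{v, u} ⥤ AddCommGrpCat.{w}, (∀ C, P C → IsZero (F.obj C)) →
      ∀ C, P C → IsZero ((contraction^[n] F).obj C) := by
  induction n with
  | zero => exact fun F hF => hF
  | succ n ih =>
    intro F hF
    rw [Function.iterate_succ_apply]
    refine ih _ fun C hC => ?_
    have : Epi (F.map (polyInclusion.app C)) := ⟨fun _ _ _ => (hF _ (hP C hC)).eq_of_src _ _⟩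
    exact isZero_contraction_of_epi F C

theorem isZero_negativeK {C : AdditiveCat.{v, u}} (h : LocallyNilRegular C) {n : ℕ} (hn : 0 < n) :
    IsZero ((negativeK n).obj C) := by
  obtain ⟨n, rfl⟩ := Nat.exists_eq_succ_of_ne_zero hn.ne'
  -- The innermost contraction is split off: its vanishing uses the ring theory, that of the outer
  -- ones is formal.
  rw [negativeK, Function.iterate_succ_apply]
  refine isZero_iterate_contraction LocallyNilRegular (fun _ => LocallyNilRegular.laurent) n _
    (fun C hC => ?_) C h
  have := epi_map_polyInclusion hC
  exact isZero_contraction_of_epi K₀ C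

end NegativeK

end

theorem theorem5p15 (A : Type u) [Category.{v} A] [Preadditive A] [HasFiniteBiproducts A]
    [IsIdempotentComplete A]
    (hA : ∀ X : A, IsArtinianRing (End X) ∨ IsArtinianRing (End X)ᵐᵒᵖ)
    (n : ℕ) (hn : 0 < n) :
    Subsingleton ((NegativeK.negativeK n).obj (NegativeK.AdditiveCat.of A)) := by
  refine AddCommGrpCat.subsingleton_of_isZero (NegativeK.isZero_negativeK (fun X => ?_) hn)
  rcases hA X with h | h
  · exact NegativeK.nilRegular_of_isArtinianRing (End X)
  · exact NegativeK.nilRegular_of_isArtinianRing_op (End X)
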